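/- For $n\ge 1$ consider the following Markov chain on the $n!$ arrangements of a deck of $n$ cards (the uniformly driven inverse riffle shuffle). At each step, independently of the past, choose $K$ uniformly from $\{1,\dots,n\}$, then choose a set of $K$ cards uniformly at random among all sets of $K$ cards, and move the chosen cards to the top of the deck, preserving the relative order of the chosen cards and of the remaining cards. Let $P_n$ be the transition matrix; its stationary distribution is uniform. Let $$s_n(t)=\max_{x,y}\bigl\{1-n!\,P_n^t(x,y)\bigr\}$$ be the separation distance after $t$ steps. Let $C_{\mathrm{Cat}}=\sum_{\ell\ge0}(-1)^\ell/(2\ell+1)^2$ be Catalan's constant, let $\Phi_{\mathrm G}$ be the standard normal distribution function, and set $$a=\frac{4}{4-\pi},\qquad b=\frac{4\sqrt{4+\pi\log 2-4C_{\mathrm{Cat}}-\pi^2/4}}{(4-\pi)^{3/2}}.$$ Then for every $c\in\mathbb R$, $$s_n\bigl(\lfloor a\log n+bc\sqrt{\log n}\rfloor\bigr)\longrightarrow 1-\Phi_{\mathrm G}(c)\qquad(n\to\infty).$$ Consequently the shuffle has separation cutoff at times $t_n=a\log n$ with window $w_n=\sqrt{\log n}$: that is, $w_n=o(t_n)$,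 the limits below exist for every $c \in \mathbb R$ as $n\to\infty$, and $$\lim_{c\to\infty}\lim_{n\to\infty}s_n(\lfloor t_n-cw_n\rfloor)=1,\qquad \lim_{c\to\infty}\lim_{n\to\infty}s_n(\lfloor t_n+cw_n\rfloor)=0.$$ -/

import Mathlib

open Filter Topology

/-- The separation distance at time `t` of the chain with transition matrix `P` and stationary
distribution `π`: the maximum over starting states `x` and target states `y` of
`1 - P^t(x, y) / π(y)`. -/
noncomputable def separationDistance {X : Type*} [Fintype X] [DecidableEq X]
    (P : Matrix X X ℝ) (π : X → ℝ) (t : ℕ) : ℝ :=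
  ⨆ x : X, ⨆ y : X, (1 - (P ^ t) x y / π y)

/-- `s n t` is a distance to stationarity of the `n`-th chain at time `t`. The sequence of chains
has cutoff at times `t n` with window `w n` if `w n = o(t n)` and the iterated limits
`lim_{c → ∞} lim_{n → ∞} s n (t n - c * w n)` and `lim_{c → ∞} lim_{n → ∞} s n (t n + c * w n)`
exist and equal `1` and `0` respectively. Non-integer times are rounded down. -/
def HasCutoff (s : ℕ → ℕ → ℝ) (t w : ℕ → ℝ) : Prop :=
  w =o[atTop] t ∧
  (∃ L : ℝ → ℝ,
    (∀ c : ℝ, Tendsto (fun n : ℕ => s n ⌊t n - c * w n⌋₊) atTop (𝓝 (L c))) ∧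
    Tendsto L atTop (𝓝 1)) ∧
  (∃ L : ℝ → ℝ,
    (∀ c : ℝ, Tendsto (fun n : ℕ => s n ⌊t n + c * w n⌋₊) atTop (𝓝 (L c))) ∧
    Tendsto L atTop (𝓝 0))

/-- The rearrangement of positions that puts the positions in `A` first and the other positions
after them, each group in increasing order. It sends a new position to the old position whose
card it receives. -/
def moveToFront {n : ℕ} (A : Finset (Fin n)) : Equiv.Perm (Fin n) :=
  (finCongr (show n = A.card + (Aᶜ).card by
    rw [Finset.card_add_card_compl, Fintype.card_fin])).trans
    (finSumFinEquiv.symm.trans (finSumEquivOfFinset (s := A) rfl rfl))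

/-- A deck of `n` cards is a permutation `σ` of `Fin n`: the card at position `p` is `σ p`, and
position `0` is the top. `moveCardsToTop B σ` is the deck obtained from `σ` by moving the cards in
`B` to the top, preserving the relative order within `B` and within its complement. -/
def moveCardsToTop {n : ℕ} (B : Finset (Fin n)) (σ : Equiv.Perm (Fin n)) :
    Equiv.Perm (Fin n) :=
  (moveToFront (B.map σ.symm.toEmbedding)).trans σ

/-- Transition matrix of the inverse riffle shuffle with uniform pile size: choose `k` uniformly
from `{1, …, n}`, then a uniform set `B` of `k` of the `n` cards, and move `B` to the top. -/
noncomputable def uniformRiffle (n : ℕ) :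
    Matrix (Equiv.Perm (Fin n)) (Equiv.Perm (Fin n)) ℝ := fun σ τ =>
  ∑ k ∈ Finset.Icc 1 n, (1 / (n : ℝ)) *
    ∑ B ∈ (Finset.univ : Finset (Fin n)).powersetCard k,
      (1 / (n.choose k : ℝ)) * (if moveCardsToTop B σ = τ then 1 else 0)

/-- The uniform distribution on the `n!` decks. -/
noncomputable def uniformDeck (n : ℕ) : Equiv.Perm (Fin n) → ℝ :=
  fun _ => 1 / (n.factorial : ℝ)

/-- The separation distance of the uniformly driven inverse riffle shuffle of `n` cards. -/
noncomputable def riffleSeparation (n t : ℕ) : ℝ :=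
  separationDistance (uniformRiffle n) (uniformDeck n) t

/-- Catalan's constant `∑ (-1)^l / (2l+1)^2`. -/
noncomputable def catalanConstant : ℝ := ∑' l : ℕ, (-1 : ℝ) ^ l / (2 * (l : ℝ) + 1) ^ 2

/-- The leading constant `a = 4 / (4 - π)`. -/
noncomputable def riffleA : ℝ := 4 / (4 - Real.pi)

/-- The window constant `b`. -/
noncomputable def riffleB : ℝ :=
  4 * Real.sqrt (4 + Real.pi * Real.log 2 - 4 * catalanConstant - Real.pi ^ 2 / 4) /
    (4 - Real.pi) ^ (3 / 2 : ℝ)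

/-- The distribution function of the standard normal law. -/
noncomputable def normalCDF (c : ℝ) : ℝ :=
  ProbabilityTheory.cdf (ProbabilityTheory.gaussianReal 0 1) c

/-! The following facts confirm that the shuffle acts on decks as described and that it is an
irreducible Markov chain whose stationary distribution is uniform. -/

theorem moveToFront_lt_iff {n : ℕ} (A : Finset (Fin n)) (i j : Fin n) :
    (moveToFront A).symm i < (moveToFront A).symm j ↔
      (i ∈ A ∧ j ∉ A) ∨ ((i ∈ A ↔ j ∈ A) ∧ i < j) := by
  obtain ⟨u, rfl⟩ : ∃ u, i = finSumEquivOfFinset (s := A) rfl rfl u :=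
    ⟨_, (Equiv.apply_symm_apply _ i).symm⟩
  obtain ⟨v, rfl⟩ : ∃ v, j = finSumEquivOfFinset (s := A) rfl rfl v :=
    ⟨_, (Equiv.apply_symm_apply _ j).symm⟩
  have key : ∀ u : Fin A.card ⊕ Fin (Aᶜ).card,
      (((moveToFront A).symm (finSumEquivOfFinset (s := A) rfl rfl u) : Fin n) : ℕ)
        = (finSumFinEquiv u : ℕ) := by
    intro u
    simp [moveToFront]
  rw [Fin.lt_def, key, key]
  have hc : ∀ x : Fin (Aᶜ).card, (Aᶜ).orderEmbOfFin rfl x ∉ A := fun x =>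
    Finset.mem_compl.1 (Finset.orderEmbOfFin_mem _ _ x)
  have hm : ∀ x : Fin A.card, A.orderEmbOfFin rfl x ∈ A := fun x =>
    Finset.orderEmbOfFin_mem _ _ x
  rcases u with u | u <;> rcases v with v | v
  · simp [hm]
  · simp [hm, hc]; omega
  · simp [hm, hc]; omega
  · simp [hc]

/-- Card `i` lies above card `j` in the new deck iff `i` was chosen and `j` was not, or both or
neither were chosen and `i` was already above `j`. -/
theorem moveCardsToTop_lt_iff {n : ℕ} (B : Finset (Fin n)) (σ : Equiv.Perm (Fin n))
    (i j : Fin n) :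
    (moveCardsToTop B σ).symm i < (moveCardsToTop B σ).symm j ↔
      (i ∈ B ∧ j ∉ B) ∨ ((i ∈ B ↔ j ∈ B) ∧ σ.symm i < σ.symm j) := by
  simp [moveCardsToTop, moveToFront_lt_iff]

theorem uniformRiffle_nonneg {n : ℕ} (σ τ : Equiv.Perm (Fin n)) : 0 ≤ uniformRiffle n σ τ := by
  unfold uniformRiffle
  refine Finset.sum_nonneg fun k _ => mul_nonneg (by positivity)
    (Finset.sum_nonneg fun B _ => mul_nonneg (by positivity) ?_)
  split_ifs <;> norm_num

theorem uniformRiffle_weights {n : ℕ} (hn : 1 ≤ n) :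
    ∑ k ∈ Finset.Icc 1 n, (1 / (n : ℝ)) *
      ∑ _B ∈ (Finset.univ : Finset (Fin n)).powersetCard k, (1 / (n.choose k : ℝ)) = 1 := by
  have h : ∀ k ∈ Finset.Icc 1 n, (1 / (n : ℝ)) *
      ∑ _B ∈ (Finset.univ : Finset (Fin n)).powersetCard k, (1 / (n.choose k : ℝ))
        = 1 / (n : ℝ) := by
    intro k hk
    have : (n.choose k : ℝ) ≠ 0 := by
      exact_mod_cast (Nat.choose_pos (Finset.mem_Icc.1 hk).2).ne'
    simp [this]
  rw [Finset.sum_congr rfl h]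
  have : (n : ℝ) ≠ 0 := by exact_mod_cast (by omega : n ≠ 0)
  simp [this]

/-- The rows of the transition matrix sum to one. -/
theorem uniformRiffle_row_sum {n : ℕ} (hn : 1 ≤ n) (σ : Equiv.Perm (Fin n)) :
    ∑ τ, uniformRiffle n σ τ = 1 := by
  unfold uniformRiffle
  rw [Finset.sum_comm]
  refine (Finset.sum_congr rfl fun k _ => ?_).trans (uniformRiffle_weights hn)
  rw [← Finset.mul_sum, Finset.sum_comm]
  simp

/-- The columns of the transition matrix sum to one. -/
theorem uniformRiffle_col_sum {n : ℕ} (hn : 1 ≤ n) (τ : Equiv.Perm (Fin n)) :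
    ∑ σ, uniformRiffle n σ τ = 1 := by
  have h : ∀ σ, uniformRiffle n σ τ = ∑ k ∈ Finset.Icc 1 n, (1 / (n : ℝ)) *
      ∑ A ∈ (Finset.univ : Finset (Fin n)).powersetCard k,
        (1 / (n.choose k : ℝ)) * (if (moveToFront A).trans σ = τ then 1 else 0) := by
    intro σ
    refine Finset.sum_congr rfl fun k _ => ?_
    congr 1
    refine Finset.sum_bij (fun B _ => B.map σ.symm.toEmbedding) ?_ ?_ ?_ ?_
    · intro B hB
      simpa [Finset.mem_powersetCard] using hB
    · intro B _ B' _ hBB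
      exact Finset.map_injective _ hBB
    · intro A hA
      refine ⟨A.map σ.toEmbedding, by simpa [Finset.mem_powersetCard] using hA, ?_⟩
      ext x; simp
    · intro B _
      rfl
  simp_rw [h]
  rw [Finset.sum_comm]
  refine (Finset.sum_congr rfl fun k _ => ?_).trans (uniformRiffle_weights hn)
  rw [← Finset.mul_sum, Finset.sum_comm]
  congr 1
  refine Finset.sum_congr rfl fun A _ => ?_
  rw [← Finset.mul_sum]
  have : ∀ σ : Equiv.Perm (Fin n),
      ((moveToFront A).trans σ = τ) = (σ = (moveToFront A).symm.trans τ) := by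
    intro σ
    apply propext
    constructor
    · rintro rfl; ext x; simp
    · rintro rfl; ext x; simp
  simp [this]

/-- The uniform distribution is stationary for the shuffle. -/
theorem uniformDeck_stationary {n : ℕ} (hn : 1 ≤ n) :
    Matrix.vecMul (uniformDeck n) (uniformRiffle n) = uniformDeck n := by
  funext τ
  simp only [Matrix.vecMul, dotProduct, uniformDeck]
  rw [← Finset.mul_sum, uniformRiffle_col_sum hn, mul_one]

theorem uniformDeck_sum (n : ℕ) : ∑ σ, uniformDeck n σ = 1 := by
  have : (n.factorial : ℝ) ≠ 0 := by exact_mod_cast n.factorial_ne_zero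
  simp [uniformDeck, Fintype.card_perm, this]

/-- Every non-empty set of cards has positive probability of being the chosen pile. -/
theorem uniformRiffle_pos {n : ℕ} (B : Finset (Fin n)) (hB : B.Nonempty)
    (σ : Equiv.Perm (Fin n)) : 0 < uniformRiffle n σ (moveCardsToTop B σ) := by
  have hcard : B.card ≤ n := by simpa using Finset.card_le_univ B
  have h1 : 1 ≤ B.card := hB.card_pos
  have hn : (0 : ℝ) < n := by exact_mod_cast (by omega : 0 < n)
  have hch : (0 : ℝ) < n.choose B.card := by exact_mod_cast Nat.choose_pos hcard
  have hnn : ∀ k, ∀ C ∈ (Finset.univ : Finset (Fin n)).powersetCard k, (0 : ℝ) ≤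
      (1 / (n.choose k : ℝ)) *
        (if moveCardsToTop C σ = moveCardsToTop B σ then 1 else 0) := by
    intro k C _
    refine mul_nonneg (by positivity) ?_
    split_ifs <;> norm_num
  unfold uniformRiffle
  refine Finset.sum_pos' (fun k _ => mul_nonneg (by positivity) (Finset.sum_nonneg (hnn k)))
    ⟨B.card, Finset.mem_Icc.2 ⟨h1, hcard⟩, mul_pos (by positivity) ?_⟩
  refine Finset.sum_pos' (hnn _) ⟨B, by simp [Finset.mem_powersetCard], ?_⟩
  simp [hch]

/-- The shuffle is irreducible. -/
theorem uniformRiffle_irreducible {n : ℕ} (hn : 1 ≤ n) :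
    (uniformRiffle n).IsIrreducible := by
  rw [Matrix.isIrreducible_iff_exists_pow_pos uniformRiffle_nonneg]
  intro σ τ
  have step : ∀ (k : ℕ) (x y z : Equiv.Perm (Fin n)), 0 < ((uniformRiffle n) ^ k) x y →
      0 < uniformRiffle n y z → 0 < ((uniformRiffle n) ^ (k + 1)) x z := by
    intro k x y z hk hz
    rw [pow_succ, Matrix.mul_apply]
    refine Finset.sum_pos' (fun w _ => mul_nonneg ?_ (uniformRiffle_nonneg _ _))
      ⟨y, Finset.mem_univ _, mul_pos hk hz⟩
    exact Matrix.pow_apply_nonneg uniformRiffle_nonneg k x w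
  have claim : ∀ m : ℕ, m ≤ n → ∃ ρ : Equiv.Perm (Fin n), 0 < ((uniformRiffle n) ^ m) σ ρ ∧
      ∀ i j : Fin n, n - m ≤ (τ.symm i : ℕ) →
        ((τ.symm j : ℕ) < n - m ∨ τ.symm i < τ.symm j) → ρ.symm i < ρ.symm j := by
    intro m
    induction m with
    | zero =>
      intro _
      refine ⟨σ, by simp, fun i j hi => ?_⟩
      have := (τ.symm i).2
      omega
    | succ m ih =>
      intro hm
      obtain ⟨ρ, hρ, hρ'⟩ := ih (by omega)
      let q : Fin n := ⟨n - (m + 1), by omega⟩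
      refine ⟨moveCardsToTop {τ q} ρ, step _ _ _ _ hρ
        (uniformRiffle_pos _ (Finset.singleton_nonempty _) _), fun i j hi hij => ?_⟩
      have hq : ∀ x, x = τ q ↔ (τ.symm x : ℕ) = n - (m + 1) := by
        intro x
        rw [← Equiv.symm_apply_eq, Fin.ext_iff]
      rw [moveCardsToTop_lt_iff]
      simp only [Finset.mem_singleton, hq]
      rw [Fin.lt_def] at hij
      by_cases h : (τ.symm i : ℕ) = n - (m + 1)
      · left; omega
      · right
        refine ⟨by omega, hρ' i j (by omega) ?_⟩
        rw [Fin.lt_def]; omega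
  obtain ⟨ρ, hρ, hρ'⟩ := claim n le_rfl
  refine ⟨n, by omega, ?_⟩
  have hmono : StrictMono (τ.trans ρ.symm) := by
    intro x y hxy
    exact (hρ' (τ x) (τ y) (by omega) (Or.inr (by simpa using hxy)))
  have hid : ∀ x, ρ.symm (τ x) = x := by
    intro x
    have := Subsingleton.elim
      (StrictMono.orderIsoOfSurjective _ hmono (τ.trans ρ.symm).surjective) (OrderIso.refl _)
    simpa using congrArg (fun f : Fin n ≃o Fin n => f x) this
  have : ρ = τ := by
    ext x
    have := hid x
    rw [Equiv.symm_apply_eq] at this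
    rw [this]
  rwa [this] at hρ

/-! Label each card by the record of which piles contain it. The relative order of two cards is
decided by the last pile containing exactly one of them, and is inherited from the initial deck if
there is no such pile. Once all labels differ, the initial deck is therefore forgotten, and by
invariance under relabelling of cards the deck is conditionally uniform. So every entry of `P^t` is
at least `1/n!` times the probability of distinct labels. The reversal of the initial deck is
reachable only with distinct labels, so equality holds there: the separation distance is exactly the
probability that two cards share a label (`riffleSeparation_eq`).

Now condition on the pile sizes `K s`. Two cards share a label with probability close to `R = ∏ p(K
s / n)`, where `p(u) = u² + (1 - u)²`, so the number of ordered unseparated pairs has mean close to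
`x = n² R`. The first moment shows that distinct labels are likely when `x` is small
(`one_sub_le_distinctProbGiven`). The second moment, in which overlapping pairs contribute only the
orders `x^(3/2)` and `x`, shows that they are unlikely when `x` is large (`distinctProbGiven_le`).
Sampling without replacement costs factors `(1 + O(1/n))^t`, harmless since `t = O(log n)`.

The outcome is thus governed by the sign of `log x = 2 log n + ∑ log p(K s / n)`. Setting `K s = ⌈n
U s⌉` with one sequence of independent uniform variables, the same for all `n`, changes the sum by
`O(t/n)` only. The central limit theorem applies to `∑ log p(U s)`, whose terms have mean `π/2 - 2`
and variance `σ²` equal to `logAgreeVar`; Catalan's constant enters through the second moment. A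
margin `M = (log n)^(1/4)` around the threshold forces `x` to `0` or `∞` on the two sides, yet is
invisible on the scale `√(log n)` (`tendsto_distinctProb`). Solving for the time gives `a = 2/(2 -
π/2)` and `b = σ √a/(2 - π/2)`. -/

/-! ### Relative order of cards under a sequence of piles -/

/-- Two decks with the same order relation between cards are equal. -/
theorem deck_ext_of_lt_iff {n : ℕ} {σ τ : Equiv.Perm (Fin n)}
    (h : ∀ i j, σ.symm i < σ.symm j ↔ τ.symm i < τ.symm j) : σ = τ := by
  have hmono : StrictMono (τ.trans σ.symm) := by
    intro x y hxy
    exact (h (τ x) (τ y)).2 (by simpa using hxy)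
  have hid : ∀ x, σ.symm (τ x) = x := by
    intro x
    have := Subsingleton.elim
      (StrictMono.orderIsoOfSurjective _ hmono (τ.trans σ.symm).surjective) (OrderIso.refl _)
    simpa using congrArg (fun f : Fin n ≃o Fin n => f x) this
  ext x
  have := hid x
  rw [Equiv.symm_apply_eq] at this
  rw [this]

/-- The deck obtained from `σ` by successively moving the piles `B 0`, `B 1`, … to the top. -/
def runShuffles {n : ℕ} : (t : ℕ) → (Fin t → Finset (Fin n)) → Equiv.Perm (Fin n) →
    Equiv.Perm (Fin n)
  | 0, _, σ => σ
  | t + 1, B, σ => runShuffles t (Fin.tail B) (moveCardsToTop (B 0) σ)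

/-- Cards `i` and `j` belong to exactly the same piles. -/
def SameLabel {n t : ℕ} (B : Fin t → Finset (Fin n)) (i j : Fin n) : Prop :=
  ∀ s, i ∈ B s ↔ j ∈ B s

/-- Any two different cards are separated by some pile. -/
def LabelsDistinct {n t : ℕ} (B : Fin t → Finset (Fin n)) : Prop :=
  ∀ i j, SameLabel B i j → i = j

instance {n t : ℕ} (B : Fin t → Finset (Fin n)) (i j : Fin n) : Decidable (SameLabel B i j) := by
  unfold SameLabel; infer_instance

instance {n t : ℕ} (B : Fin t → Finset (Fin n)) : Decidable (LabelsDistinct B) := by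
  unfold LabelsDistinct; infer_instance

theorem SameLabel.tail {n t : ℕ} {B : Fin (t + 1) → Finset (Fin n)} {i j : Fin n}
    (h : SameLabel B i j) : SameLabel (Fin.tail B) i j := fun s => h s.succ

theorem sameLabel_succ_iff {n t : ℕ} {B : Fin (t + 1) → Finset (Fin n)} {i j : Fin n} :
    SameLabel B i j ↔ (i ∈ B 0 ↔ j ∈ B 0) ∧ SameLabel (Fin.tail B) i j := by
  unfold SameLabel
  rw [Fin.forall_fin_succ]
  rfl

/-- A pile containing both cards or neither of them leaves their relative order alone. -/
theorem runShuffles_lt_iff_of_sameLabel {n t : ℕ} (B : Fin t → Finset (Fin n))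
    (σ : Equiv.Perm (Fin n)) {i j : Fin n} (h : SameLabel B i j) :
    (runShuffles t B σ).symm i < (runShuffles t B σ).symm j ↔ σ.symm i < σ.symm j := by
  induction t generalizing σ with
  | zero => rfl
  | succ t ih =>
    rw [runShuffles, ih _ _ h.tail, moveCardsToTop_lt_iff]
    have := h 0
    tauto

/-- The last pile containing exactly one of the two cards puts that card above the other, and later
piles do not alter this. Both starting decks are general because the induction removes the first
pile, which changes them. -/
theorem runShuffles_lt_iff_of_not_sameLabel {n t : ℕ} (B : Fin t → Finset (Fin n))
    (σ τ : Equiv.Perm (Fin n)) {i j : Fin n} (h : ¬ SameLabel B i j) :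
    (runShuffles t B σ).symm i < (runShuffles t B σ).symm j ↔
      (runShuffles t B τ).symm i < (runShuffles t B τ).symm j := by
  induction t generalizing σ τ with
  | zero => exact absurd (fun s => s.elim0) h
  | succ t ih =>
    by_cases ht : SameLabel (Fin.tail B) i j
    · have h0 : ¬ (i ∈ B 0 ↔ j ∈ B 0) := fun h0 => h (sameLabel_succ_iff.2 ⟨h0, ht⟩)
      rw [runShuffles, runShuffles, runShuffles_lt_iff_of_sameLabel _ _ ht,
        runShuffles_lt_iff_of_sameLabel _ _ ht, moveCardsToTop_lt_iff, moveCardsToTop_lt_iff]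
      tauto
    · exact ih _ _ _ ht

/-- Once all cards are separated, the initial deck is forgotten. -/
theorem LabelsDistinct.runShuffles_eq {n t : ℕ} {B : Fin t → Finset (Fin n)}
    (h : LabelsDistinct B) (σ τ : Equiv.Perm (Fin n)) :
    runShuffles t B σ = runShuffles t B τ := by
  refine deck_ext_of_lt_iff fun i j => ?_
  by_cases hij : i = j
  · simp [hij]
  · exact runShuffles_lt_iff_of_not_sameLabel B σ τ fun hs => hij (h i j hs)

/-- The reversed deck can only be reached once all cards are separated. -/
theorem labelsDistinct_of_runShuffles_eq_rev {n t : ℕ} {B : Fin t → Finset (Fin n)}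
    {σ : Equiv.Perm (Fin n)} (h : runShuffles t B σ = Fin.revPerm.trans σ) :
    LabelsDistinct B := by
  intro i j hs
  have h1 := runShuffles_lt_iff_of_sameLabel B σ hs
  have h2 := runShuffles_lt_iff_of_sameLabel B σ (i := j) (j := i) (fun s => (hs s).symm)
  rw [h] at h1 h2
  simp only [Equiv.symm_trans_apply, Fin.revPerm_symm, Fin.revPerm_apply, Fin.rev_lt_rev] at h1 h2
  apply σ.symm.injective
  rcases lt_trichotomy (σ.symm i) (σ.symm j) with h3 | h3 | h3
  · exact absurd (h1.2 h3) h3.asymm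
  · exact h3
  · exact absurd (h1.1 h3) h3.asymm

/-- The shuffle acts on positions, so it commutes with renaming the cards; this symmetry produces
the uniform law below. -/
theorem moveCardsToTop_map {n : ℕ} (π : Equiv.Perm (Fin n)) (B : Finset (Fin n))
    (σ : Equiv.Perm (Fin n)) :
    moveCardsToTop (B.map π.toEmbedding) (σ.trans π) = (moveCardsToTop B σ).trans π := by
  refine deck_ext_of_lt_iff fun i j => ?_
  simp [moveCardsToTop_lt_iff, Finset.mem_map_equiv]

theorem runShuffles_map {n t : ℕ} (π : Equiv.Perm (Fin n)) (B : Fin t → Finset (Fin n))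
    (σ : Equiv.Perm (Fin n)) :
    runShuffles t (fun s => (B s).map π.toEmbedding) (σ.trans π) =
      (runShuffles t B σ).trans π := by
  induction t generalizing σ with
  | zero => rfl
  | succ t ih =>
    rw [runShuffles, runShuffles, moveCardsToTop_map]
    exact ih (Fin.tail B) _

theorem labelsDistinct_map_iff {n t : ℕ} (π : Equiv.Perm (Fin n)) (B : Fin t → Finset (Fin n)) :
    LabelsDistinct (fun s => (B s).map π.toEmbedding) ↔ LabelsDistinct B := by
  unfold LabelsDistinct SameLabel
  simp only [Finset.mem_map_equiv]
  constructor
  · intro h i j hs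
    exact π.injective (h (π i) (π j) (by simpa using hs))
  · intro h i j hs
    exact π.symm.injective (h _ _ hs)

/-! ### Separation distance as the probability of a repeated label -/

/-- The uniform distribution on piles of size `k`. -/
noncomputable def pileWeight (n k : ℕ) (B : Finset (Fin n)) : ℝ :=
  if B.card = k then 1 / (n.choose k : ℝ) else 0

/-- The distribution of a pile whose size is uniform on `{1, …, n}`. -/
noncomputable def riffleWeight (n : ℕ) (B : Finset (Fin n)) : ℝ :=
  ∑ k : Fin n, (1 / (n : ℝ)) * pileWeight n (k + 1) B

/-- The probability that `t` random piles separate all cards. -/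
noncomputable def distinctProb (n t : ℕ) : ℝ :=
  ∑ B : Fin t → Finset (Fin n), (∏ s, riffleWeight n (B s)) * if LabelsDistinct B then 1 else 0

theorem pileWeight_nonneg (n k : ℕ) (B : Finset (Fin n)) : 0 ≤ pileWeight n k B := by
  unfold pileWeight; split_ifs <;> positivity

theorem riffleWeight_nonneg (n : ℕ) (B : Finset (Fin n)) : 0 ≤ riffleWeight n B :=
  Finset.sum_nonneg fun _ _ => mul_nonneg (by positivity) (pileWeight_nonneg _ _ _)

theorem riffleWeight_map {n : ℕ} (π : Equiv.Perm (Fin n)) (B : Finset (Fin n)) :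
    riffleWeight n (B.map π.toEmbedding) = riffleWeight n B := by
  simp [riffleWeight, pileWeight]

theorem uniformRiffle_eq_sum {n : ℕ} (σ τ : Equiv.Perm (Fin n)) :
    uniformRiffle n σ τ =
      ∑ B, riffleWeight n B * if moveCardsToTop B σ = τ then 1 else 0 := by
  have h1 : uniformRiffle n σ τ = ∑ k ∈ Finset.Icc 1 n, ∑ B : Finset (Fin n),
      (1 / (n : ℝ)) * pileWeight n k B * if moveCardsToTop B σ = τ then 1 else 0 := by
    refine Finset.sum_congr rfl fun k _ => ?_
    have h : (Finset.univ : Finset (Finset (Fin n))).filter (fun B => B.card = k) =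
        (Finset.univ : Finset (Fin n)).powersetCard k := by
      ext B; simp [Finset.mem_powersetCard]
    rw [Finset.mul_sum, ← h, Finset.sum_filter]
    refine Finset.sum_congr rfl fun B _ => ?_
    unfold pileWeight
    split_ifs <;> simp
  rw [h1, Finset.sum_comm]
  refine Finset.sum_congr rfl fun B _ => ?_
  rw [← Finset.sum_mul]
  congr 1
  rw [riffleWeight, Fin.sum_univ_eq_sum_range
    (fun k => (1 / (n : ℝ)) * pileWeight n (k + 1) B) n, Finset.sum_bij (fun k _ => k - 1)]
  · intro k hk; simp at hk ⊢; omega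
  · intro a ha b hb h; simp at ha hb h; omega
  · intro b hb; refine ⟨b + 1, ?_, ?_⟩ <;> simp at hb ⊢; omega
  · intro k hk
    simp at hk
    rw [Nat.sub_add_cancel hk.1]

/-- Splitting off the first factor of the power matches the recursion of `runShuffles`, so the chain
is driven by `t` independent piles. -/
theorem uniformRiffle_pow_apply {n : ℕ} (t : ℕ) (σ τ : Equiv.Perm (Fin n)) :
    (uniformRiffle n ^ t) σ τ = ∑ B : Fin t → Finset (Fin n),
      (∏ s, riffleWeight n (B s)) * if runShuffles t B σ = τ then 1 else 0 := by
  induction t generalizing σ with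
  | zero =>
    simp only [pow_zero, Matrix.one_apply, runShuffles]
    by_cases h : σ = τ <;> simp [h]
  | succ t ih =>
    rw [pow_succ', Matrix.mul_apply]
    simp_rw [ih, uniformRiffle_eq_sum]
    rw [← (Fin.consEquiv fun _ : Fin (t + 1) => Finset (Fin n)).sum_comp, Fintype.sum_prod_type]
    simp only [Fin.consEquiv_apply, Fin.prod_univ_succ, Fin.cons_zero, Fin.cons_succ, runShuffles]
    simp_rw [Finset.sum_mul]
    rw [Finset.sum_comm]
    refine Finset.sum_congr rfl fun B _ => ?_
    simp_rw [mul_ite, mul_one, mul_zero, ite_mul, zero_mul]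
    rw [Finset.sum_ite_eq]
    simp only [Finset.mem_univ, if_true, Finset.mul_sum, mul_ite, mul_zero]
    rfl

/-- Given that all cards are separated, every deck is equally likely. -/
theorem sum_labelsDistinct_runShuffles {n : ℕ} (t : ℕ) (σ τ : Equiv.Perm (Fin n)) :
    ∑ B : Fin t → Finset (Fin n), (∏ s, riffleWeight n (B s)) *
      (if LabelsDistinct B ∧ runShuffles t B σ = τ then 1 else 0) =
        distinctProb n t / n.factorial := by
  set F : Equiv.Perm (Fin n) → ℝ := fun τ => ∑ B : Fin t → Finset (Fin n),
    (∏ s, riffleWeight n (B s)) *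
      (if LabelsDistinct B ∧ runShuffles t B σ = τ then 1 else 0) with hF
  have hconst : ∀ ρ, F ρ = F τ := by
    intro ρ
    -- The renaming that turns the target `ρ` into `τ`; it preserves pile weights and distinctness.
    set π : Equiv.Perm (Fin n) := ρ.symm.trans τ
    let e : (Fin t → Finset (Fin n)) ≃ (Fin t → Finset (Fin n)) :=
      Equiv.piCongrRight fun _ => π.finsetCongr
    have he : ∀ B, e B = fun s => (B s).map π.toEmbedding := fun B => rfl
    simp only [hF]
    rw [← e.sum_comp (fun B => (∏ s, riffleWeight n (B s)) *
      (if LabelsDistinct B ∧ runShuffles t B σ = τ then (1 : ℝ) else 0))]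
    refine Finset.sum_congr rfl fun B _ => ?_
    simp only [he, riffleWeight_map, labelsDistinct_map_iff]
    congr 1
    by_cases hB : LabelsDistinct B
    · have h1 : runShuffles t (fun s => (B s).map π.toEmbedding) σ =
          (runShuffles t B σ).trans π := by
        -- Renaming also moves the start to `σ.trans π`; distinct labels make the start irrelevant,
        -- so it can be exchanged with `σ`.
        rw [((labelsDistinct_map_iff π B).2 hB).runShuffles_eq σ (σ.trans π), runShuffles_map]
      rw [h1]
      have h2 : (runShuffles t B σ = ρ) ↔ ((runShuffles t B σ).trans π = τ) := by
        constructor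
        · rintro rfl; ext x; simp [π]
        · intro h
          ext x
          have := congrArg (fun f : Equiv.Perm (Fin n) => ρ (τ.symm (f x))) h
          simp [π] at this
          exact congrArg Fin.val this
      simp only [h2]
    · simp [hB]
  have hsum : ∑ ρ, F ρ = distinctProb n t := by
    simp only [hF, distinctProb]
    rw [Finset.sum_comm]
    refine Finset.sum_congr rfl fun B _ => ?_
    rw [← Finset.mul_sum]
    congr 1
    by_cases hB : LabelsDistinct B <;> simp [hB]
  have hcard : ∑ ρ, F ρ = n.factorial * F τ := by
    rw [Finset.sum_congr rfl fun ρ _ => hconst ρ]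
    simp [Fintype.card_perm]
  have : (n.factorial : ℝ) ≠ 0 := by exact_mod_cast n.factorial_ne_zero
  change F τ = _
  rw [eq_div_iff this, ← hsum, hcard, mul_comm]

/-- The separation distance is the probability that some two cards are not yet separated. -/
theorem riffleSeparation_eq (n t : ℕ) : riffleSeparation n t = 1 - distinctProb n t := by
  have hn : (0 : ℝ) < n.factorial := by exact_mod_cast n.factorial_pos
  have hle : ∀ σ τ : Equiv.Perm (Fin n),
      1 - (uniformRiffle n ^ t) σ τ / uniformDeck n τ ≤ 1 - distinctProb n t := by
    intro σ τ
    rw [uniformDeck, div_div_eq_mul_div, div_one]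
    have h := sum_labelsDistinct_runShuffles t σ τ
    have : distinctProb n t / n.factorial ≤ (uniformRiffle n ^ t) σ τ := by
      rw [← h, uniformRiffle_pow_apply]
      refine Finset.sum_le_sum fun B _ => mul_le_mul_of_nonneg_left ?_
        (Finset.prod_nonneg fun _ _ => riffleWeight_nonneg _ _)
      split_ifs with h1 h2 h2 <;> first | exact absurd h1.2 h2 | norm_num
    rw [div_le_iff₀ hn] at this
    linarith
  -- The extremal pair: for the reversed target, requiring distinct labels is no restriction, so the
  -- lower bound on the entry is attained.
  have hge : 1 - (uniformRiffle n ^ t) (Equiv.refl _) (Fin.revPerm.trans (Equiv.refl _)) /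
      uniformDeck n (Fin.revPerm.trans (Equiv.refl _)) = 1 - distinctProb n t := by
    rw [uniformDeck, div_div_eq_mul_div, div_one, uniformRiffle_pow_apply]
    have h := sum_labelsDistinct_runShuffles t (Equiv.refl (Fin n))
      (Fin.revPerm.trans (Equiv.refl _))
    have h2 : ∀ B : Fin t → Finset (Fin n), (LabelsDistinct B ∧
        runShuffles t B (Equiv.refl _) = Fin.revPerm.trans (Equiv.refl _)) ↔
        runShuffles t B (Equiv.refl _) = Fin.revPerm.trans (Equiv.refl _) :=
      fun B => ⟨And.right, fun h => ⟨labelsDistinct_of_runShuffles_eq_rev h, h⟩⟩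
    simp only [h2] at h
    rw [h, div_mul_cancel₀ _ hn.ne']
  unfold riffleSeparation separationDistance
  apply le_antisymm
  · exact ciSup_le fun σ => ciSup_le fun τ => hle σ τ
  · rw [← hge]
    exact (le_ciSup (f := fun τ => 1 - (uniformRiffle n ^ t) (Equiv.refl _) τ / uniformDeck n τ)
      (Set.finite_range _).bddAbove _).trans
      (le_ciSup (f := fun σ => ⨆ τ, (1 - (uniformRiffle n ^ t) σ τ / uniformDeck n τ))
        (Set.finite_range _).bddAbove (Equiv.refl _))

/-! ### Hypergeometric estimates for a single pile -/

/-- This is the hypergeometric probability of containing `a` given cards and avoiding `b` others,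
with denominators cleared. If `n - k < b`, both sides vanish. -/
theorem choose_mul_descFactorial_add {n k a b : ℕ} (hak : a ≤ k) (hkn : k ≤ n) (hab : a + b ≤ n) :
    (n - b - a).choose (k - a) * n.descFactorial (a + b) =
      n.choose k * (k.descFactorial a * (n - k).descFactorial b) := by
  rcases lt_or_ge (n - k) b with hb | hb
  · rw [Nat.choose_eq_zero_of_lt (by omega), Nat.descFactorial_eq_zero_iff_lt.2 hb]
    simp
  · obtain ⟨p, rfl⟩ := Nat.exists_eq_add_of_le' hak
    obtain ⟨q, hq⟩ := Nat.exists_eq_add_of_le' hb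
    have hn : n = p + q + (a + b) := by omega
    have e1 := Nat.choose_mul_factorial_mul_factorial (n := p + q) (k := p) (by omega)
    have e2 := Nat.factorial_mul_descFactorial hab
    have e3 := Nat.choose_mul_factorial_mul_factorial hkn
    have e4 := Nat.factorial_mul_descFactorial hak
    have e5 := Nat.factorial_mul_descFactorial hb
    rw [show n - (a + b) = p + q by omega] at e2
    rw [show p + a - a = p by omega] at e4
    rw [hq, show q + b - b = q by omega] at e5
    rw [hq] at e3
    rw [show p + q - p = q by omega] at e1
    rw [show n - b - a = p + q by omega, show p + a - a = p by omega, hq]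
    have hpos : 0 < p.factorial * q.factorial := by positivity
    apply Nat.eq_of_mul_eq_mul_left hpos
    calc _ = (p + q).choose p * p.factorial * q.factorial * n.descFactorial (a + b) := by ring
      _ = n.choose (p + a) * (p.factorial * (p + a).descFactorial a) *
          (q.factorial * (q + b).descFactorial b) := by rw [e1, e2, e4, e5, e3]
      _ = _ := by ring

/-- The probability that a uniform pile of size `k` contains `A` and avoids `A'`. -/
theorem sum_pileWeight_subset_disjoint {n k : ℕ} (hk : k ≤ n) {A A' : Finset (Fin n)}
    (hA : Disjoint A A') :
    ∑ B, pileWeight n k B * (if A ⊆ B ∧ Disjoint A' B then 1 else 0) =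
      (k.descFactorial A.card * (n - k).descFactorial A'.card : ℝ) /
        n.descFactorial (A.card + A'.card) := by
  have hcard : A.card + A'.card ≤ n := by
    rw [← Finset.card_union_of_disjoint hA]
    simpa using Finset.card_le_univ (A ∪ A')
  have hsum : ∑ B, pileWeight n k B * (if A ⊆ B ∧ Disjoint A' B then 1 else 0) =
      ((A'ᶜ.powersetCard k).filter (A ⊆ ·)).card * (1 / (n.choose k : ℝ)) := by
    rw [← nsmul_eq_mul, ← Finset.sum_const]
    have h : (A'ᶜ.powersetCard k).filter (A ⊆ ·) =
        Finset.univ.filter (fun B => B.card = k ∧ A ⊆ B ∧ Disjoint A' B) := by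
      ext B
      simp only [Finset.mem_filter, Finset.mem_powersetCard, Finset.mem_univ, true_and,
        Finset.subset_compl_iff_disjoint_left]
      tauto
    rw [h, Finset.sum_filter]
    refine Finset.sum_congr rfl fun B _ => ?_
    unfold pileWeight
    split_ifs <;> first | (exfalso; tauto) | simp
  rw [hsum]
  rcases lt_or_ge k A.card with hlt | hle
  · rw [Nat.descFactorial_eq_zero_iff_lt.2 hlt]
    have : (A'ᶜ.powersetCard k).filter (A ⊆ ·) = ∅ := by
      refine Finset.filter_eq_empty_iff.2 fun B hB hAB => ?_
      have := Finset.card_le_card hAB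
      have := (Finset.mem_powersetCard.1 hB).2
      omega
    simp [this]
  · rw [Finset.card_filter_powersetCard_subset _ _ _
      (Finset.subset_compl_iff_disjoint_right.2 hA) hle, Finset.card_compl, Fintype.card_fin]
    have h := choose_mul_descFactorial_add hle hk hcard
    have h1 : (n.choose k : ℝ) ≠ 0 := by exact_mod_cast (Nat.choose_pos hk).ne'
    have h2 : (n.descFactorial (A.card + A'.card) : ℝ) ≠ 0 := by
      exact_mod_cast (Nat.descFactorial_pos.2 hcard).ne'
    rw [mul_one_div, div_eq_div_iff h1 h2]
    have h' := congrArg (Nat.cast : ℕ → ℝ) h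
    push_cast at h'
    rw [h']; ring

theorem sum_pileWeight {n k : ℕ} (hk : k ≤ n) : ∑ B, pileWeight n k B = 1 := by
  have := sum_pileWeight_subset_disjoint hk (Finset.disjoint_empty_left (∅ : Finset (Fin n)))
  simpa using this

/-- The correction factor between sampling with and without replacement. -/
noncomputable def replacementFactor (n : ℕ) : ℝ := (n : ℝ) ^ 4 / n.descFactorial 4

/-- Falling factorials are bounded by powers, which compares the pile with independent placement of
cards. One correction factor serves all events about at most four cards. -/
theorem sum_pileWeight_subset_disjoint_le {n k : ℕ} (hn : 4 ≤ n) (hk : k ≤ n)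
    {A A' : Finset (Fin n)} (hA : Disjoint A A') (hcard : A.card + A'.card ≤ 4) :
    ∑ B, pileWeight n k B * (if A ⊆ B ∧ Disjoint A' B then 1 else 0) ≤
      replacementFactor n * (((k : ℝ) / n) ^ A.card * (1 - (k : ℝ) / n) ^ A'.card) := by
  rw [sum_pileWeight_subset_disjoint hk hA]
  set a := A.card
  set b := A'.card
  have hn0 : (0 : ℝ) < n := by exact_mod_cast (by omega : 0 < n)
  have h1 : (k.descFactorial a : ℝ) ≤ (k : ℝ) ^ a := by exact_mod_cast Nat.descFactorial_le_pow k a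
  have h2 : ((n - k).descFactorial b : ℝ) ≤ ((n : ℝ) - k) ^ b := by
    rw [← Nat.cast_sub hk]; exact_mod_cast Nat.descFactorial_le_pow (n - k) b
  -- Each of the missing factors of the falling factorial is at most `n`.
  have h3 : (n.descFactorial 4 : ℝ) ≤ n ^ (4 - (a + b)) * n.descFactorial (a + b) := by
    rw [← Nat.descFactorial_mul_descFactorial hcard]
    push_cast
    gcongr
    exact_mod_cast (Nat.descFactorial_le_pow _ _).trans (Nat.pow_le_pow_left (by omega) _)
  have h4 : (0 : ℝ) < n.descFactorial 4 := by exact_mod_cast Nat.descFactorial_pos.2 hn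
  have h5 : (0 : ℝ) < n.descFactorial (a + b) := by
    exact_mod_cast Nat.descFactorial_pos.2 (by omega)
  have hkn : (0 : ℝ) ≤ (n : ℝ) - k := by
    rw [← Nat.cast_sub hk]; positivity
  have h6 : replacementFactor n * (((k : ℝ) / n) ^ a * (1 - (k : ℝ) / n) ^ b) =
      (n : ℝ) ^ (4 - (a + b)) * ((k : ℝ) ^ a * ((n : ℝ) - k) ^ b) / n.descFactorial 4 := by
    have : 1 - (k : ℝ) / n = ((n : ℝ) - k) / n := by field_simp
    have h7 : (n : ℝ) ^ 4 = (n : ℝ) ^ (4 - (a + b)) * ((n : ℝ) ^ a * (n : ℝ) ^ b) := by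
      rw [← pow_add, ← pow_add]; congr 1; omega
    rw [this, replacementFactor, div_pow, div_pow, h7]
    field_simp
  rw [h6, div_le_div_iff₀ h5 h4]
  calc (k.descFactorial a * (n - k).descFactorial b : ℝ) * n.descFactorial 4
      ≤ ((k : ℝ) ^ a * ((n : ℝ) - k) ^ b) *
        (n ^ (4 - (a + b)) * n.descFactorial (a + b)) := by gcongr
    _ = _ := by ring

/-- The probability that two independent cards fall on the same side. -/
def agreeProb (u : ℝ) : ℝ := u ^ 2 + (1 - u) ^ 2

theorem half_le_agreeProb (u : ℝ) : 1 / 2 ≤ agreeProb u := by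
  unfold agreeProb; nlinarith [sq_nonneg (2 * u - 1)]

theorem agreeProb_pos (u : ℝ) : 0 < agreeProb u := by
  linarith [half_le_agreeProb u]

theorem sum_pileWeight_agree_le {n k : ℕ} (hn : 4 ≤ n) (hk : k ≤ n) {i j : Fin n} (hij : i ≠ j) :
    ∑ B, pileWeight n k B * (if (i ∈ B ↔ j ∈ B) then 1 else 0) ≤
      replacementFactor n * agreeProb ((k : ℝ) / n) := by
  have h1 := sum_pileWeight_subset_disjoint_le hn hk
    (Finset.disjoint_empty_right ({i, j} : Finset (Fin n))) (by simp [hij])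
  have h2 := sum_pileWeight_subset_disjoint_le hn hk
    (Finset.disjoint_empty_left ({i, j} : Finset (Fin n))) (by simp [hij])
  have h3 : ∑ B, pileWeight n k B * (if (i ∈ B ↔ j ∈ B) then 1 else 0) =
      ∑ B, pileWeight n k B *
        (if ({i, j} : Finset (Fin n)) ⊆ B ∧ Disjoint (∅ : Finset (Fin n)) B then 1 else 0) +
      ∑ B, pileWeight n k B *
        (if (∅ : Finset (Fin n)) ⊆ B ∧ Disjoint ({i, j} : Finset (Fin n)) B then 1 else 0) := by
    rw [← Finset.sum_add_distrib]
    refine Finset.sum_congr rfl fun B _ => ?_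
    by_cases hi : i ∈ B <;> by_cases hj : j ∈ B <;> simp [hi, hj, Finset.insert_subset_iff]
  rw [h3]
  refine (add_le_add h1 h2).trans_eq ?_
  simp [hij, agreeProb]
  ring

/-- The exact value is `(k(k-1) + (n-k)(n-k-1)) / (n(n-1))`, which loses only a relative `O(1/n)`
against independent placement because `agreeProb` is at least `1/2`. -/
theorem le_sum_pileWeight_agree {n k : ℕ} (hn : 4 ≤ n) (hk : k ≤ n) {i j : Fin n} (hij : i ≠ j) :
    (1 - 2 / (n : ℝ)) * agreeProb ((k : ℝ) / n) ≤
      ∑ B, pileWeight n k B * (if (i ∈ B ↔ j ∈ B) then 1 else 0) := by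
  have h1 := sum_pileWeight_subset_disjoint hk
    (Finset.disjoint_empty_right ({i, j} : Finset (Fin n)))
  have h2 := sum_pileWeight_subset_disjoint hk
    (Finset.disjoint_empty_left ({i, j} : Finset (Fin n)))
  have h3 : ∑ B, pileWeight n k B * (if (i ∈ B ↔ j ∈ B) then 1 else 0) =
      ∑ B, pileWeight n k B *
        (if ({i, j} : Finset (Fin n)) ⊆ B ∧ Disjoint (∅ : Finset (Fin n)) B then 1 else 0) +
      ∑ B, pileWeight n k B *
        (if (∅ : Finset (Fin n)) ⊆ B ∧ Disjoint ({i, j} : Finset (Fin n)) B then 1 else 0) := by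
    rw [← Finset.sum_add_distrib]
    refine Finset.sum_congr rfl fun B _ => ?_
    by_cases hi : i ∈ B <;> by_cases hj : j ∈ B <;> simp [hi, hj, Finset.insert_subset_iff]
  rw [h3, h1, h2]
  have hd : ∀ m : ℕ, (m.descFactorial 2 : ℝ) = m * (m - 1) := by
    intro m
    rcases m with _ | m
    · simp
    · simp [Nat.descFactorial]
      ring
  simp only [Finset.card_pair hij, Finset.card_empty, Nat.descFactorial_zero, Nat.cast_one, mul_one,
    one_mul, add_zero, zero_add, hd, Nat.cast_sub hk]
  have hn' : (4 : ℝ) ≤ n := by exact_mod_cast hn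
  have hn0 : (0 : ℝ) < n := by linarith
  have hn1 : (0 : ℝ) < (n : ℝ) - 1 := by linarith
  have hag := half_le_agreeProb ((k : ℝ) / n)
  have hag1 : agreeProb ((k : ℝ) / n) * n ^ 2 = (k : ℝ) ^ 2 + ((n : ℝ) - k) ^ 2 := by
    unfold agreeProb; field_simp
  have hkn : (k : ℝ) ≤ n := by exact_mod_cast hk
  rw [← add_div, le_div_iff₀ (by positivity)]
  have e1 : (1 - 2 / (n : ℝ)) * agreeProb ((k : ℝ) / n) * (n * (n - 1)) =
      agreeProb ((k : ℝ) / n) * n ^ 2 - 3 * n * agreeProb ((k : ℝ) / n) +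
        2 * agreeProb ((k : ℝ) / n) := by
    field_simp; ring
  rw [e1, hag1]
  -- With `p` the value of `agreeProb`, it remains to see that `(3n - 2) p ≥ n`, which follows from
  -- `p ≥ 1/2`.
  nlinarith

theorem sum_pileWeight_agree_triple_le {n k : ℕ} (hn : 4 ≤ n) (hk : k ≤ n) {i j l : Fin n}
    (hij : i ≠ j) (hil : i ≠ l) (hjl : j ≠ l) :
    ∑ B, pileWeight n k B * (if (i ∈ B ↔ j ∈ B) ∧ (i ∈ B ↔ l ∈ B) then 1 else 0) ≤
      replacementFactor n * (((k : ℝ) / n) ^ 3 + (1 - (k : ℝ) / n) ^ 3) := by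
  have hc : ({i, j, l} : Finset (Fin n)).card = 3 := Finset.card_eq_three.2 ⟨i, j, l, hij, hil, hjl, rfl⟩
  have h1 := sum_pileWeight_subset_disjoint_le hn hk
    (Finset.disjoint_empty_right ({i, j, l} : Finset (Fin n))) (by simp [hc])
  have h2 := sum_pileWeight_subset_disjoint_le hn hk
    (Finset.disjoint_empty_left ({i, j, l} : Finset (Fin n))) (by simp [hc])
  have h3 : ∑ B, pileWeight n k B * (if (i ∈ B ↔ j ∈ B) ∧ (i ∈ B ↔ l ∈ B) then 1 else 0) =
      ∑ B, pileWeight n k B *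
        (if ({i, j, l} : Finset (Fin n)) ⊆ B ∧ Disjoint (∅ : Finset (Fin n)) B then 1 else 0) +
      ∑ B, pileWeight n k B *
        (if (∅ : Finset (Fin n)) ⊆ B ∧ Disjoint ({i, j, l} : Finset (Fin n)) B then 1 else 0) := by
    rw [← Finset.sum_add_distrib]
    refine Finset.sum_congr rfl fun B _ => ?_
    by_cases hi : i ∈ B <;> by_cases hj : j ∈ B <;> by_cases hl : l ∈ B <;>
      simp [hi, hj, hl, Finset.insert_subset_iff]
  rw [h3]
  refine (add_le_add h1 h2).trans_eq ?_
  simp [hc]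
  ring

/-- Each pair lies wholly inside or wholly outside the pile; the four cases add up to `u⁴ + (1-u)⁴ +
2u²(1-u)²`, a perfect square, so disjoint pairs are nearly independent. -/
theorem sum_pileWeight_agree_agree_le {n k : ℕ} (hn : 4 ≤ n) (hk : k ≤ n) {i j l m : Fin n}
    (hij : i ≠ j) (hlm : l ≠ m) (hil : i ≠ l) (him : i ≠ m) (hjl : j ≠ l) (hjm : j ≠ m) :
    ∑ B, pileWeight n k B * (if (i ∈ B ↔ j ∈ B) ∧ (l ∈ B ↔ m ∈ B) then 1 else 0) ≤
      replacementFactor n * agreeProb ((k : ℝ) / n) ^ 2 := by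
  have hc : ({i, j, l, m} : Finset (Fin n)).card = 4 := by
    rw [Finset.card_insert_of_notMem (by simp [hij, hil, him]),
      Finset.card_insert_of_notMem (by simp [hjl, hjm]), Finset.card_pair hlm]
  have hd : Disjoint ({i, j} : Finset (Fin n)) {l, m} := by
    rw [Finset.disjoint_left]
    simp only [Finset.mem_insert, Finset.mem_singleton]
    rintro a (rfl | rfl) <;> tauto
  have h1 := sum_pileWeight_subset_disjoint_le hn hk
    (Finset.disjoint_empty_right ({i, j, l, m} : Finset (Fin n))) (by simp [hc])
  have h2 := sum_pileWeight_subset_disjoint_le hn hk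
    (Finset.disjoint_empty_left ({i, j, l, m} : Finset (Fin n))) (by simp [hc])
  have h3 := sum_pileWeight_subset_disjoint_le hn hk hd
    (by simp [Finset.card_pair hij, Finset.card_pair hlm])
  have h4 := sum_pileWeight_subset_disjoint_le hn hk hd.symm
    (by simp [Finset.card_pair hij, Finset.card_pair hlm])
  have h5 : ∑ B, pileWeight n k B * (if (i ∈ B ↔ j ∈ B) ∧ (l ∈ B ↔ m ∈ B) then 1 else 0) =
      ∑ B, pileWeight n k B *
        (if ({i, j, l, m} : Finset (Fin n)) ⊆ B ∧ Disjoint (∅ : Finset (Fin n)) B then 1 else 0) +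
      ∑ B, pileWeight n k B *
        (if (∅ : Finset (Fin n)) ⊆ B ∧ Disjoint ({i, j, l, m} : Finset (Fin n)) B
          then 1 else 0) +
      ∑ B, pileWeight n k B *
        (if ({i, j} : Finset (Fin n)) ⊆ B ∧ Disjoint ({l, m} : Finset (Fin n)) B then 1 else 0) +
      ∑ B, pileWeight n k B *
        (if ({l, m} : Finset (Fin n)) ⊆ B ∧ Disjoint ({i, j} : Finset (Fin n)) B
          then 1 else 0) := by
    rw [← Finset.sum_add_distrib, ← Finset.sum_add_distrib, ← Finset.sum_add_distrib]
    refine Finset.sum_congr rfl fun B _ => ?_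
    by_cases hi : i ∈ B <;> by_cases hj : j ∈ B <;> by_cases hl : l ∈ B <;>
      by_cases hm : m ∈ B <;> simp [hi, hj, hl, hm, Finset.insert_subset_iff]
  rw [h5]
  refine (add_le_add (add_le_add (add_le_add h1 h2) h3) h4).trans_eq ?_
  rw [hc, Finset.card_pair hij, Finset.card_pair hlm]
  simp [agreeProb]
  ring

/-! ### Label coincidences given the pile sizes -/

/-- The probability that independent uniform piles of sizes `K s` separate all cards. -/
noncomputable def distinctProbGiven (n : ℕ) {t : ℕ} (K : Fin t → ℕ) : ℝ :=
  ∑ B : Fin t → Finset (Fin n),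
    (∏ s, pileWeight n (K s) (B s)) * if LabelsDistinct B then 1 else 0

/-- Expanding the product of mixtures conditions on the sequence of pile sizes; `K s` takes values
in `Fin n`, hence the shift by one. -/
theorem distinctProb_eq_sum (n t : ℕ) :
    distinctProb n t =
      (1 / (n : ℝ)) ^ t * ∑ K : Fin t → Fin n, distinctProbGiven n (fun s => (K s : ℕ) + 1) := by
  unfold distinctProb distinctProbGiven riffleWeight
  rw [Finset.mul_sum]
  simp_rw [Fintype.prod_sum, Finset.sum_mul]
  rw [Finset.sum_comm]
  refine Finset.sum_congr rfl fun K _ => ?_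
  rw [Finset.mul_sum]
  refine Finset.sum_congr rfl fun B _ => ?_
  rw [Finset.prod_mul_distrib]
  simp

theorem sum_prod_pileWeight_forall {n t : ℕ} (K : Fin t → ℕ) (p : Finset (Fin n) → Prop)
    [DecidablePred p] :
    ∑ B : Fin t → Finset (Fin n),
        (∏ s, pileWeight n (K s) (B s)) * (if ∀ s, p (B s) then 1 else 0) =
      ∏ s, ∑ B, pileWeight n (K s) B * (if p B then 1 else 0) := by
  rw [Fintype.prod_sum]
  refine Finset.sum_congr rfl fun B _ => ?_
  rw [Finset.prod_mul_distrib, Finset.prod_boole]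
  simp

theorem prod_pileWeight_nonneg {n t : ℕ} (K : Fin t → ℕ) (B : Fin t → Finset (Fin n)) :
    0 ≤ ∏ s, pileWeight n (K s) (B s) :=
  Finset.prod_nonneg fun _ _ => pileWeight_nonneg _ _ _

theorem sum_prod_pileWeight {n t : ℕ} {K : Fin t → ℕ} (hK : ∀ s, K s ≤ n) :
    ∑ B : Fin t → Finset (Fin n), ∏ s, pileWeight n (K s) (B s) = 1 := by
  rw [← Fintype.prod_sum]
  exact Finset.prod_eq_one fun s _ => sum_pileWeight (hK s)

theorem distinctProbGiven_nonneg {n t : ℕ} (K : Fin t → ℕ) : 0 ≤ distinctProbGiven n K :=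
  Finset.sum_nonneg fun B _ => mul_nonneg (prod_pileWeight_nonneg K B) (by split_ifs <;> simp)

theorem distinctProbGiven_le_one {n t : ℕ} {K : Fin t → ℕ} (hK : ∀ s, K s ≤ n) :
    distinctProbGiven n K ≤ 1 := by
  rw [← sum_prod_pileWeight hK]
  exact Finset.sum_le_sum fun B _ => mul_le_of_le_one_right (prod_pileWeight_nonneg K B)
    (by split_ifs <;> simp)

theorem replacementFactor_nonneg (n : ℕ) : 0 ≤ replacementFactor n := by
  unfold replacementFactor; positivity

/-- The probability that independent cards placed according to the proportions `K s / n` agree at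
every step. -/
noncomputable def agreeProd (n : ℕ) {t : ℕ} (K : Fin t → ℕ) : ℝ :=
  ∏ s, agreeProb ((K s : ℝ) / n)

theorem agreeProd_pos (n : ℕ) {t : ℕ} (K : Fin t → ℕ) : 0 < agreeProd n K :=
  Finset.prod_pos fun _ _ => agreeProb_pos _

section PairProbabilities

variable {n t : ℕ} {K : Fin t → ℕ}

theorem pow_card_mul_prod (c : ℝ) (f : Fin t → ℝ) : c ^ t * ∏ s, f s = ∏ s, c * f s := by
  rw [Finset.prod_mul_distrib]; simp

theorem sum_nonneg_of_indicator (k : ℕ) (p : Finset (Fin n) → Prop) [DecidablePred p] :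
    0 ≤ ∑ B, pileWeight n k B * (if p B then 1 else 0) :=
  Finset.sum_nonneg fun _ _ => mul_nonneg (pileWeight_nonneg _ _ _) (by split_ifs <;> simp)

theorem prob_sameLabel_le (hn : 4 ≤ n) (hK : ∀ s, K s ≤ n) {i j : Fin n} (hij : i ≠ j) :
    ∑ B : Fin t → Finset (Fin n),
        (∏ s, pileWeight n (K s) (B s)) * (if SameLabel B i j then 1 else 0) ≤
      replacementFactor n ^ t * agreeProd n K := by
  unfold SameLabel
  rw [sum_prod_pileWeight_forall K (fun B => (i ∈ B ↔ j ∈ B)), agreeProd, pow_card_mul_prod]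
  exact Finset.prod_le_prod (fun s _ => sum_nonneg_of_indicator _ _)
    fun s _ => sum_pileWeight_agree_le hn (hK s) hij

theorem le_prob_sameLabel (hn : 4 ≤ n) (hK : ∀ s, K s ≤ n) {i j : Fin n} (hij : i ≠ j) :
    (1 - 2 / (n : ℝ)) ^ t * agreeProd n K ≤ ∑ B : Fin t → Finset (Fin n),
        (∏ s, pileWeight n (K s) (B s)) * (if SameLabel B i j then 1 else 0) := by
  unfold SameLabel
  rw [sum_prod_pileWeight_forall K (fun B => (i ∈ B ↔ j ∈ B)), agreeProd, pow_card_mul_prod]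
  have h : 0 ≤ 1 - 2 / (n : ℝ) := by
    have : (4 : ℝ) ≤ n := by exact_mod_cast hn
    rw [sub_nonneg, div_le_one (by linarith)]
    linarith
  exact Finset.prod_le_prod (fun s _ => mul_nonneg h (agreeProb_pos _).le)
    fun s _ => le_sum_pileWeight_agree hn (hK s) hij

/-- The `ℓ³` norm of `(u, 1-u)` is at most its `ℓ²` norm. This bounds the triple coincidence by the
power `3/2` of the pair coincidence, so the second moment depends on the pile sizes only through
`agreeProd`. -/
theorem cube_add_cube_le {u : ℝ} (h0 : 0 ≤ u) (h1 : u ≤ 1) :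
    u ^ 3 + (1 - u) ^ 3 ≤ agreeProb u * Real.sqrt (agreeProb u) := by
  have hp := agreeProb_pos u
  have h : u ^ 3 + (1 - u) ^ 3 ≤ Real.sqrt (agreeProb u ^ 3) := by
    apply Real.le_sqrt_of_sq_le
    have hu : 0 ≤ u * (1 - u) := mul_nonneg h0 (by linarith)
    have e1 : u ^ 3 + (1 - u) ^ 3 = 1 - 3 * (u * (1 - u)) := by ring
    have e2 : agreeProb u = 1 - 2 * (u * (1 - u)) := by unfold agreeProb; ring
    rw [e1, e2]
    have h3 : u * (1 - u) ≤ 1 / 4 := by nlinarith [sq_nonneg (2 * u - 1)]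
    -- With `w = u(1-u)`, the difference `(1-2w)³ - (1-3w)²` equals `w²(3-8w)`, nonnegative since `w
    -- ≤ 1/4`.
    nlinarith [mul_nonneg hu hu, mul_nonneg (mul_nonneg hu hu) hu]
  refine h.trans_eq ?_
  rw [show agreeProb u ^ 3 = agreeProb u ^ 2 * agreeProb u by ring,
    Real.sqrt_mul (by positivity), Real.sqrt_sq hp.le]

theorem prod_agree_mul_sqrt :
    ∏ s, (agreeProb ((K s : ℝ) / n) * Real.sqrt (agreeProb ((K s : ℝ) / n))) =
      agreeProd n K * Real.sqrt (agreeProd n K) := by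
  rw [Finset.prod_mul_distrib, agreeProd, Real.sqrt_prod _ fun s _ => (agreeProb_pos _).le]

theorem prob_sameLabel_triple_le (hn : 4 ≤ n) (hK : ∀ s, K s ≤ n) {i j l : Fin n}
    (hij : i ≠ j) (hil : i ≠ l) (hjl : j ≠ l) :
    ∑ B : Fin t → Finset (Fin n), (∏ s, pileWeight n (K s) (B s)) *
        (if SameLabel B i j ∧ SameLabel B i l then 1 else 0) ≤
      replacementFactor n ^ t * (agreeProd n K * Real.sqrt (agreeProd n K)) := by
  unfold SameLabel
  simp_rw [← forall_and]
  rw [sum_prod_pileWeight_forall K (fun B => (i ∈ B ↔ j ∈ B) ∧ (i ∈ B ↔ l ∈ B)),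
    ← prod_agree_mul_sqrt, pow_card_mul_prod]
  refine Finset.prod_le_prod (fun s _ => sum_nonneg_of_indicator _ _) fun s _ =>
    (sum_pileWeight_agree_triple_le hn (hK s) hij hil hjl).trans
      (mul_le_mul_of_nonneg_left (cube_add_cube_le (by positivity) ?_)
        (replacementFactor_nonneg n))
  exact div_le_one_of_le₀ (by exact_mod_cast hK s) (by positivity)

theorem prob_sameLabel_pair_pair_le (hn : 4 ≤ n) (hK : ∀ s, K s ≤ n) {i j l m : Fin n}
    (hij : i ≠ j) (hlm : l ≠ m) (hil : i ≠ l) (him : i ≠ m) (hjl : j ≠ l) (hjm : j ≠ m) :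
    ∑ B : Fin t → Finset (Fin n), (∏ s, pileWeight n (K s) (B s)) *
        (if SameLabel B i j ∧ SameLabel B l m then 1 else 0) ≤
      replacementFactor n ^ t * agreeProd n K ^ 2 := by
  unfold SameLabel
  simp_rw [← forall_and]
  rw [sum_prod_pileWeight_forall K (fun B => (i ∈ B ↔ j ∈ B) ∧ (l ∈ B ↔ m ∈ B)),
    agreeProd, ← Finset.prod_pow, pow_card_mul_prod]
  exact Finset.prod_le_prod (fun s _ => sum_nonneg_of_indicator _ _) fun s _ =>
    sum_pileWeight_agree_agree_le hn (hK s) hij hlm hil him hjl hjm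

end PairProbabilities

/-! ### First and second moments of the number of unseparated pairs -/

/-- Number of ordered pairs of different cards that are not separated. -/
def unseparatedPairs {n t : ℕ} (B : Fin t → Finset (Fin n)) : ℝ :=
  ∑ i, ∑ j, if i ≠ j ∧ SameLabel B i j then 1 else 0

theorem unseparatedPairs_nonneg {n t : ℕ} (B : Fin t → Finset (Fin n)) :
    0 ≤ unseparatedPairs B :=
  Finset.sum_nonneg fun _ _ => Finset.sum_nonneg fun _ _ => by split_ifs <;> simp

theorem LabelsDistinct.unseparatedPairs_eq_zero {n t : ℕ} {B : Fin t → Finset (Fin n)}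
    (h : LabelsDistinct B) : unseparatedPairs B = 0 :=
  Finset.sum_eq_zero fun i _ => Finset.sum_eq_zero fun j _ =>
    if_neg fun hij => hij.1 (h i j hij.2)

theorem one_le_unseparatedPairs {n t : ℕ} {B : Fin t → Finset (Fin n)}
    (h : ¬ LabelsDistinct B) : 1 ≤ unseparatedPairs B := by
  unfold LabelsDistinct at h
  push Not at h
  obtain ⟨i, j, hs, hij⟩ := h
  have h0 : ∀ i j : Fin n, (0 : ℝ) ≤ if i ≠ j ∧ SameLabel B i j then 1 else 0 :=
    fun i j => by split_ifs <;> simp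
  calc (1 : ℝ) = if i ≠ j ∧ SameLabel B i j then 1 else 0 := by simp [hij, hs]
    _ ≤ ∑ j, if i ≠ j ∧ SameLabel B i j then 1 else 0 :=
      Finset.single_le_sum (f := fun j => if i ≠ j ∧ SameLabel B i j then (1 : ℝ) else 0)
        (fun j _ => h0 i j) (Finset.mem_univ j)
    _ ≤ _ := Finset.single_le_sum
        (f := fun i => ∑ j, if i ≠ j ∧ SameLabel B i j then (1 : ℝ) else 0)
        (fun i _ => Finset.sum_nonneg fun j _ => h0 i j) (Finset.mem_univ i)

theorem expect_unseparatedPairs {n t : ℕ} (K : Fin t → ℕ) :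
    ∑ B : Fin t → Finset (Fin n), (∏ s, pileWeight n (K s) (B s)) * unseparatedPairs B =
      ∑ i : Fin n, ∑ j : Fin n, ∑ B : Fin t → Finset (Fin n), (∏ s, pileWeight n (K s) (B s)) *
        (if i ≠ j ∧ SameLabel B i j then 1 else 0) := by
  unfold unseparatedPairs
  simp_rw [Finset.mul_sum]
  rw [Finset.sum_comm]
  refine Finset.sum_congr rfl fun i _ => ?_
  rw [Finset.sum_comm]

/-- First moment bound. -/
theorem one_sub_le_distinctProbGiven {n t : ℕ} (hn : 4 ≤ n) {K : Fin t → ℕ}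
    (hK : ∀ s, K s ≤ n) :
    1 - replacementFactor n ^ t * (n ^ 2 * agreeProd n K) ≤ distinctProbGiven n K := by
  have h1 : 1 - distinctProbGiven n K ≤
      ∑ B : Fin t → Finset (Fin n), (∏ s, pileWeight n (K s) (B s)) * unseparatedPairs B := by
    rw [← sum_prod_pileWeight hK, distinctProbGiven, ← Finset.sum_sub_distrib]
    refine Finset.sum_le_sum fun B _ => ?_
    rw [← mul_one_sub]
    refine mul_le_mul_of_nonneg_left ?_ (prod_pileWeight_nonneg K B)
    split_ifs with h
    · simpa using unseparatedPairs_nonneg B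
    · simpa using one_le_unseparatedPairs h
  rw [expect_unseparatedPairs] at h1
  have h2 : ∀ i j : Fin n, ∑ B : Fin t → Finset (Fin n), (∏ s, pileWeight n (K s) (B s)) *
      (if i ≠ j ∧ SameLabel B i j then 1 else 0) ≤ replacementFactor n ^ t * agreeProd n K := by
    intro i j
    by_cases hij : i = j
    · simpa [hij] using
        mul_nonneg (pow_nonneg (replacementFactor_nonneg n) t) (agreeProd_pos n K).le
    · simpa [hij] using prob_sameLabel_le hn hK hij
  have h3 := Finset.sum_le_sum fun i (_ : i ∈ Finset.univ) =>
    Finset.sum_le_sum fun j (_ : j ∈ Finset.univ) => h2 i j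
  simp only [Finset.sum_const, Finset.card_univ, Fintype.card_fin, nsmul_eq_mul] at h3
  linarith

theorem le_expect_unseparatedPairs {n t : ℕ} (hn : 4 ≤ n) {K : Fin t → ℕ} (hK : ∀ s, K s ≤ n) :
    (1 - 1 / (n : ℝ)) * (1 - 2 / (n : ℝ)) ^ t * (n ^ 2 * agreeProd n K) ≤
      ∑ B : Fin t → Finset (Fin n), (∏ s, pileWeight n (K s) (B s)) * unseparatedPairs B := by
  rw [expect_unseparatedPairs]
  have h2 : ∀ i j : Fin n,
      (if i = j then 0 else (1 - 2 / (n : ℝ)) ^ t * agreeProd n K) ≤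
      ∑ B : Fin t → Finset (Fin n), (∏ s, pileWeight n (K s) (B s)) *
      (if i ≠ j ∧ SameLabel B i j then 1 else 0) := by
    intro i j
    by_cases hij : i = j
    · simp [hij]
    · simpa [hij] using le_prob_sameLabel hn hK hij
  refine le_trans (le_of_eq ?_) (Finset.sum_le_sum fun i (_ : i ∈ Finset.univ) =>
    Finset.sum_le_sum fun j (_ : j ∈ Finset.univ) => h2 i j)
  have h3 : ∀ i : Fin n, ∑ j : Fin n,
      (if i = j then 0 else (1 - 2 / (n : ℝ)) ^ t * agreeProd n K) =
        (n - 1) * ((1 - 2 / (n : ℝ)) ^ t * agreeProd n K) := by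
    intro i
    have : ∀ j : Fin n, (if i = j then 0 else (1 - 2 / (n : ℝ)) ^ t * agreeProd n K) =
        (1 - 2 / (n : ℝ)) ^ t * agreeProd n K -
          (if i = j then (1 - 2 / (n : ℝ)) ^ t * agreeProd n K else 0) := by
      intro j; split_ifs <;> simp
    simp only [this, Finset.sum_sub_distrib, Finset.sum_const, Finset.sum_ite_eq, Finset.mem_univ,
      if_true, Finset.card_univ, Fintype.card_fin, nsmul_eq_mul]
    ring
  simp only [h3, Finset.sum_const, Finset.card_univ, Fintype.card_fin, nsmul_eq_mul]
  have : (n : ℝ) ≠ 0 := by exact_mod_cast (by omega : n ≠ 0)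
  field_simp

/-- The probability that two pairs of cards are both unseparated, according to how the pairs
overlap. -/
theorem prob_two_pairs_le {n t : ℕ} (hn : 4 ≤ n) {K : Fin t → ℕ} (hK : ∀ s, K s ≤ n)
    (i j l m : Fin n) :
    ∑ B : Fin t → Finset (Fin n), (∏ s, pileWeight n (K s) (B s)) *
        ((if i ≠ j ∧ SameLabel B i j then 1 else 0) *
          (if l ≠ m ∧ SameLabel B l m then 1 else 0)) ≤
      replacementFactor n ^ t * (agreeProd n K ^ 2 +
        agreeProd n K * Real.sqrt (agreeProd n K) * ((if i = l then 1 else 0) +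
          (if i = m then 1 else 0) + (if j = l then 1 else 0) + (if j = m then 1 else 0)) +
        agreeProd n K * ((if i = l then 1 else 0) * (if j = m then 1 else 0) +
          (if i = m then 1 else 0) * (if j = l then 1 else 0))) := by
  have hε := pow_nonneg (replacementFactor_nonneg n) t
  have hR := (agreeProd_pos n K).le
  have hS := Real.sqrt_nonneg (agreeProd n K)
  have hRS := mul_nonneg hR hS
  set ε := replacementFactor n ^ t
  set R := agreeProd n K
  have hind : ∀ p : Prop, [Decidable p] → (0 : ℝ) ≤ if p then 1 else 0 :=
    fun p _ => by split_ifs <;> simp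
  have hrhs : 0 ≤ R ^ 2 + R * Real.sqrt R * ((if i = l then 1 else 0) +
          (if i = m then 1 else 0) + (if j = l then 1 else 0) + (if j = m then 1 else 0)) +
        R * ((if i = l then 1 else 0) * (if j = m then 1 else 0) +
          (if i = m then 1 else 0) * (if j = l then 1 else 0)) := by
    have := hind (i = l)
    have := hind (i = m)
    have := hind (j = l)
    have := hind (j = m)
    positivity
  by_cases hij : i = j
  · simpa [hij] using mul_nonneg hε (by simpa [hij] using hrhs)
  by_cases hlm : l = m
  · simpa [hlm] using mul_nonneg hε (by simpa [hlm] using hrhs)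
  have hsimp : ∀ B : Fin t → Finset (Fin n),
      ((if i ≠ j ∧ SameLabel B i j then (1 : ℝ) else 0) *
        (if l ≠ m ∧ SameLabel B l m then 1 else 0)) =
      if SameLabel B i j ∧ SameLabel B l m then 1 else 0 := by
    intro B
    by_cases h1 : SameLabel B i j <;> by_cases h2 : SameLabel B l m <;> simp [hij, hlm, h1, h2]
  simp only [hsimp]
  -- Two pairs sharing exactly one card amount to one coincidence of three cards; `a` is the shared
  -- card.
  have triple : ∀ a b c : Fin n, a ≠ b → a ≠ c → b ≠ c →
      (∀ B : Fin t → Finset (Fin n), (SameLabel B i j ∧ SameLabel B l m) →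
        (SameLabel B a b ∧ SameLabel B a c)) →
      ∑ B : Fin t → Finset (Fin n), (∏ s, pileWeight n (K s) (B s)) *
        (if SameLabel B i j ∧ SameLabel B l m then 1 else 0) ≤ ε * (R * Real.sqrt R) := by
    intro a b c hab hac hbc himp
    refine le_trans (Finset.sum_le_sum fun B _ => mul_le_mul_of_nonneg_left ?_
      (prod_pileWeight_nonneg K B)) (prob_sameLabel_triple_le hn hK hab hac hbc)
    split_ifs with h1 h2 h2 <;> first | exact absurd (himp B h1) h2 | norm_num
  have double : ∑ B : Fin t → Finset (Fin n), (∏ s, pileWeight n (K s) (B s)) *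
        (if SameLabel B i j ∧ SameLabel B l m then 1 else 0) ≤ ε * R := by
    refine le_trans (Finset.sum_le_sum fun B _ => mul_le_mul_of_nonneg_left ?_
      (prod_pileWeight_nonneg K B)) (prob_sameLabel_le hn hK hij)
    split_ifs with h1 h2 h2 <;> first | exact absurd h1.1 h2 | norm_num
  have hR2 : 0 ≤ R ^ 2 := by positivity
  by_cases hil : i = l
  · subst hil
    by_cases hjm : j = m
    · subst hjm
      refine double.trans (mul_le_mul_of_nonneg_left ?_ hε)
      simp only [hij, Ne.symm hij, if_true, if_false]
      nlinarith
    · refine (triple i j m hij hlm hjm fun B h => h).trans (mul_le_mul_of_nonneg_left ?_ hε)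
      simp only [Ne.symm hij, hlm, hjm, if_true, if_false]
      nlinarith
  by_cases him : i = m
  · subst him
    by_cases hjl : j = l
    · subst hjl
      refine double.trans (mul_le_mul_of_nonneg_left ?_ hε)
      simp only [hij, Ne.symm hij, if_true, if_false]
      nlinarith
    · refine (triple i j l hij hil hjl fun B h => ⟨h.1, fun s => (h.2 s).symm⟩).trans
        (mul_le_mul_of_nonneg_left ?_ hε)
      simp only [Ne.symm hij, hil, hjl, if_true, if_false]
      nlinarith
  by_cases hjl : j = l
  · subst hjl
    refine (triple j i m (Ne.symm hij) hlm him
      fun B h => ⟨fun s => (h.1 s).symm, h.2⟩).trans (mul_le_mul_of_nonneg_left ?_ hε)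
    simp only [hij, him, hlm, if_true, if_false]
    nlinarith
  by_cases hjm : j = m
  · subst hjm
    refine (triple j i l (Ne.symm hij) hjl hil
      fun B h => ⟨fun s => (h.1 s).symm, fun s => (h.2 s).symm⟩).trans
      (mul_le_mul_of_nonneg_left ?_ hε)
    simp only [hij, hil, hjl, if_true, if_false]
    nlinarith
  refine (prob_sameLabel_pair_pair_le hn hK hij hlm hil him hjl hjm).trans
    (mul_le_mul_of_nonneg_left ?_ hε)
  simp [hil, him, hjl, hjm, R]

/-- With `x = n² R`, disjoint pairs contribute `n⁴ R² = x²`. The four ways of sharing one card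
contribute `n³ R^(3/2) = x^(3/2)` each, and the two ways of sharing both contribute `n² R = x` each.
-/
theorem expect_unseparatedPairs_sq_le {n t : ℕ} (hn : 4 ≤ n) {K : Fin t → ℕ}
    (hK : ∀ s, K s ≤ n) :
    ∑ B : Fin t → Finset (Fin n), (∏ s, pileWeight n (K s) (B s)) * unseparatedPairs B ^ 2 ≤
      replacementFactor n ^ t * ((n ^ 2 * agreeProd n K) ^ 2 +
        4 * ((n ^ 2 * agreeProd n K) * Real.sqrt (n ^ 2 * agreeProd n K)) +
        2 * (n ^ 2 * agreeProd n K)) := by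
  have h1 : ∑ B : Fin t → Finset (Fin n), (∏ s, pileWeight n (K s) (B s)) *
      unseparatedPairs B ^ 2 = ∑ i : Fin n, ∑ j : Fin n, ∑ l : Fin n, ∑ m : Fin n,
      ∑ B : Fin t → Finset (Fin n), (∏ s, pileWeight n (K s) (B s)) *
        ((if i ≠ j ∧ SameLabel B i j then 1 else 0) *
          (if l ≠ m ∧ SameLabel B l m then 1 else 0)) := by
    unfold unseparatedPairs
    simp_rw [sq, Finset.sum_mul, Finset.mul_sum]
    rw [Finset.sum_comm]
    refine Finset.sum_congr rfl fun i _ => ?_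
    rw [Finset.sum_comm]
    refine Finset.sum_congr rfl fun j _ => ?_
    rw [Finset.sum_comm]
    refine Finset.sum_congr rfl fun l _ => ?_
    rw [Finset.sum_comm]
  rw [h1]
  refine (Finset.sum_le_sum fun i (_ : i ∈ Finset.univ) =>
    Finset.sum_le_sum fun j (_ : j ∈ Finset.univ) =>
    Finset.sum_le_sum fun l (_ : l ∈ Finset.univ) =>
    Finset.sum_le_sum fun m (_ : m ∈ Finset.univ) =>
      prob_two_pairs_le hn hK i j l m).trans_eq ?_
  have hsq : Real.sqrt ((n : ℝ) ^ 2 * agreeProd n K) = n * Real.sqrt (agreeProd n K) := by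
    rw [Real.sqrt_mul (by positivity), Real.sqrt_sq (by positivity)]
  rw [hsq]
  simp only [← Finset.mul_sum, Finset.sum_add_distrib, Finset.sum_const, Finset.card_univ,
    Fintype.card_fin, nsmul_eq_mul, Finset.sum_ite_eq, Finset.mem_univ, if_true, mul_one,
    ← Finset.sum_mul]
  congr 1
  ring

/-- Second moment bound. -/
theorem distinctProbGiven_le {n t : ℕ} (hn : 4 ≤ n) {K : Fin t → ℕ} (hK : ∀ s, K s ≤ n) :
    distinctProbGiven n K ≤
      replacementFactor n ^ t / ((1 - 1 / (n : ℝ)) * (1 - 2 / (n : ℝ)) ^ t) ^ 2 *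
        (1 + 4 / Real.sqrt (n ^ 2 * agreeProd n K) + 2 / (n ^ 2 * agreeProd n K)) - 1 := by
  have h1 := le_expect_unseparatedPairs hn hK
  have h2 := expect_unseparatedPairs_sq_le hn hK
  set μ := ∑ B : Fin t → Finset (Fin n), (∏ s, pileWeight n (K s) (B s)) * unseparatedPairs B
    with hμ
  have hn' : (4 : ℝ) ≤ n := by exact_mod_cast hn
  have hd : 0 < (1 - 1 / (n : ℝ)) * (1 - 2 / (n : ℝ)) ^ t := by
    have h3 : 0 < 1 - 1 / (n : ℝ) := by
      rw [sub_pos, div_lt_one (by linarith)]; linarith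
    have h4 : 0 < 1 - 2 / (n : ℝ) := by
      rw [sub_pos, div_lt_one (by linarith)]; linarith
    positivity
  set d := (1 - 1 / (n : ℝ)) * (1 - 2 / (n : ℝ)) ^ t
  have hx : 0 < (n : ℝ) ^ 2 * agreeProd n K := mul_pos (by positivity) (agreeProd_pos n K)
  set x := (n : ℝ) ^ 2 * agreeProd n K
  -- Chebyshev's inequality: on the event of distinct labels the count is `0`, at distance `μ` from
  -- its mean.
  have h3 : distinctProbGiven n K * μ ^ 2 ≤ ∑ B : Fin t → Finset (Fin n),
      (∏ s, pileWeight n (K s) (B s)) * (unseparatedPairs B - μ) ^ 2 := by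
    rw [distinctProbGiven, Finset.sum_mul]
    refine Finset.sum_le_sum fun B _ => ?_
    rw [mul_assoc]
    refine mul_le_mul_of_nonneg_left ?_ (prod_pileWeight_nonneg K B)
    split_ifs with h
    · rw [h.unseparatedPairs_eq_zero]; simp
    · rw [zero_mul]; positivity
  have h4 : ∑ B : Fin t → Finset (Fin n),
      (∏ s, pileWeight n (K s) (B s)) * (unseparatedPairs B - μ) ^ 2 =
      ∑ B : Fin t → Finset (Fin n), (∏ s, pileWeight n (K s) (B s)) * unseparatedPairs B ^ 2 -
        μ ^ 2 := by
    have e : ∀ B : Fin t → Finset (Fin n),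
        (∏ s, pileWeight n (K s) (B s)) * (unseparatedPairs B - μ) ^ 2 =
        (∏ s, pileWeight n (K s) (B s)) * unseparatedPairs B ^ 2 -
          2 * μ * ((∏ s, pileWeight n (K s) (B s)) * unseparatedPairs B) +
          μ ^ 2 * ∏ s, pileWeight n (K s) (B s) := fun B => by ring
    simp only [e, Finset.sum_add_distrib, Finset.sum_sub_distrib, ← Finset.mul_sum]
    rw [sum_prod_pileWeight hK, ← hμ]
    ring
  rw [h4] at h3
  -- Since the variance is the second moment minus `μ²`, the second moment dominates `(P + 1) μ²`,
  -- with `P` the probability of distinct labels; then `μ ≥ d x` replaces the mean.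
  have h5 : (distinctProbGiven n K + 1) * (d * x) ^ 2 ≤ (distinctProbGiven n K + 1) * μ ^ 2 := by
    have := distinctProbGiven_nonneg (n := n) K
    gcongr
  have h6 : (distinctProbGiven n K + 1) * (d * x) ^ 2 ≤
      replacementFactor n ^ t * (x ^ 2 + 4 * (x * Real.sqrt x) + 2 * x) := by linarith
  have hs : 0 < Real.sqrt x := Real.sqrt_pos.2 hx
  have hss : Real.sqrt x * Real.sqrt x = x := Real.mul_self_sqrt hx.le
  rw [le_sub_iff_add_le]
  have e : replacementFactor n ^ t / d ^ 2 * (1 + 4 / Real.sqrt x + 2 / x) =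
      replacementFactor n ^ t * (x ^ 2 + 4 * (x * Real.sqrt x) + 2 * x) / (d * x) ^ 2 := by
    have : 4 / Real.sqrt x = 4 * Real.sqrt x / x := by
      rw [div_eq_div_iff hs.ne' hx.ne', mul_assoc, hss]
    rw [this]
    field_simp
  rw [e, le_div_iff₀ (by positivity)]
  exact h6

/-! ### Mean and variance of `log (agreeProb u)` for uniform `u` -/

theorem integral_pow_mul_log (m : ℕ) :
    ∫ v in (0 : ℝ)..1, v ^ m * Real.log v = -(1 / ((m : ℝ) + 1) ^ 2) := by
  have hm : (m : ℝ) + 1 ≠ 0 := by positivity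
  have h := intervalIntegral.integral_eq_sub_of_hasDerivAt_of_le
    -- The factor `v * log v` is kept together because it is continuous at `0`.
    (f := fun v : ℝ => v ^ m * (v * Real.log v) / (m + 1) - v ^ (m + 1) / (m + 1) ^ 2)
    (f' := fun v => v ^ m * Real.log v) zero_le_one ?_ ?_ ?_
  · rw [h]; simp
  · have := Real.continuous_mul_log
    fun_prop
  · intro v hv
    have hv0 : v ≠ 0 := hv.1.ne'
    have h1 := ((((hasDerivAt_pow (m + 1) v).mul (Real.hasDerivAt_log hv0)).div_const
      ((m : ℝ) + 1)).sub ((hasDerivAt_pow (m + 1) v).div_const (((m : ℝ) + 1) ^ 2)))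
    refine (h1.congr_deriv ?_).congr_of_eventuallyEq (Eventually.of_forall fun x => ?_)
    · simp only [add_tsub_cancel_right]
      push_cast
      field_simp
      ring
    · simp only [Pi.mul_apply, Pi.sub_apply]
      ring
  · exact intervalIntegral.intervalIntegrable_log'.continuousOn_mul (by fun_prop)

/-- Expanding `1/(1+v²)` as a geometric series and integrating termwise gives Catalan's series. The
remainder after `N` terms is at most `∫ v^(2N) |log v| = 1/(2N+1)²`, so no exchange of limit and
integral is needed. -/
theorem integral_log_div_one_add_sq :
    ∫ v in (0 : ℝ)..1, Real.log v / (1 + v ^ 2) = -catalanConstant := by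
  have hden : ∀ v : ℝ, 1 + v ^ 2 ≠ 0 := fun v => by positivity
  have hint : ∀ f : ℝ → ℝ, Continuous f →
      IntervalIntegrable (fun v => f v * Real.log v) MeasureTheory.volume 0 1 := fun f hf =>
    intervalIntegral.intervalIntegrable_log'.continuousOn_mul hf.continuousOn
  have hcd : Continuous fun v : ℝ => (1 + v ^ 2)⁻¹ := by
    fun_prop (disch := intro x; exact hden x)
  have hpart : ∀ N : ℕ, |(∫ v in (0 : ℝ)..1, Real.log v / (1 + v ^ 2)) +
      ∑ l ∈ Finset.range N, (-1 : ℝ) ^ l / (2 * (l : ℝ) + 1) ^ 2| ≤ 1 / (2 * (N : ℝ) + 1) ^ 2 := by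
    intro N
    have h1 : ∀ l : ℕ, (-1 : ℝ) ^ l / (2 * (l : ℝ) + 1) ^ 2 =
        -∫ v in (0 : ℝ)..1, ((-1) ^ l * v ^ (2 * l)) * Real.log v := by
      intro l
      simp_rw [mul_assoc]
      rw [intervalIntegral.integral_const_mul, integral_pow_mul_log]
      push_cast
      ring
    have h2 : ∑ l ∈ Finset.range N, (-1 : ℝ) ^ l / (2 * (l : ℝ) + 1) ^ 2 =
        -∫ v in (0 : ℝ)..1, ∑ l ∈ Finset.range N, ((-1) ^ l * v ^ (2 * l)) * Real.log v := by
      rw [intervalIntegral.integral_finsetSum fun l _ => hint _ (by fun_prop),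
        ← Finset.sum_neg_distrib]
      exact Finset.sum_congr rfl fun l _ => h1 l
    have h3 : (∫ v in (0 : ℝ)..1, Real.log v / (1 + v ^ 2)) +
        ∑ l ∈ Finset.range N, (-1 : ℝ) ^ l / (2 * (l : ℝ) + 1) ^ 2 =
        ∫ v in (0 : ℝ)..1, ((-1) ^ N * v ^ (2 * N) * (1 + v ^ 2)⁻¹) * Real.log v := by
      rw [h2, ← sub_eq_add_neg, ← intervalIntegral.integral_sub]
      · refine intervalIntegral.integral_congr fun v _ => ?_
        have hg := geom_sum_eq (x := -v ^ 2) (by nlinarith [sq_nonneg v]) N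
        have hs : ∑ l ∈ Finset.range N, ((-1) ^ l * v ^ (2 * l)) * Real.log v =
            (∑ l ∈ Finset.range N, (-v ^ 2) ^ l) * Real.log v := by
          rw [Finset.sum_mul]
          refine Finset.sum_congr rfl fun l _ => ?_
          rw [neg_pow (v ^ 2), pow_mul]
        simp only [hs, hg, neg_pow (v ^ 2) N, ← pow_mul]
        have h4 : -v ^ 2 - 1 ≠ 0 := by nlinarith [sq_nonneg v]
        have h5 := hden v
        field_simp
        ring
      · simpa [div_eq_inv_mul] using hint _ hcd
      · have : (fun v : ℝ => ∑ l ∈ Finset.range N, ((-1) ^ l * v ^ (2 * l)) * Real.log v) =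
            fun v => (∑ l ∈ Finset.range N, ((-1) ^ l * v ^ (2 * l))) * Real.log v := by
          funext v; rw [Finset.sum_mul]
        rw [this]
        exact hint _ (by fun_prop)
    rw [h3]
    have h4 := intervalIntegral.norm_integral_le_of_norm_le (a := 0) (b := 1)
      (μ := MeasureTheory.volume)
      (f := fun v : ℝ => ((-1) ^ N * v ^ (2 * N) * (1 + v ^ 2)⁻¹) * Real.log v)
      (g := fun v => -(v ^ (2 * N) * Real.log v)) zero_le_one ?_ (hint _ (by fun_prop)).neg
    · rw [intervalIntegral.integral_neg, integral_pow_mul_log] at h4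
      simpa using h4
    · refine Eventually.of_forall fun v hv => ?_
      have hl : Real.log v ≤ 0 := Real.log_nonpos hv.1.le hv.2
      have hi : (1 + v ^ 2)⁻¹ ≤ 1 := inv_le_one_of_one_le₀ (by nlinarith [sq_nonneg v])
      have hp : 0 ≤ v ^ (2 * N) := pow_nonneg hv.1.le _
      rw [norm_mul, norm_mul, norm_mul, norm_pow, norm_neg, norm_one, one_pow, one_mul,
        Real.norm_of_nonneg hp, Real.norm_of_nonpos hl, Real.norm_of_nonneg (by positivity),
        ← mul_neg]
      exact mul_le_mul_of_nonneg_right (mul_le_of_le_one_right hp hi) (by linarith)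
  have hsum : Summable fun l : ℕ => (-1 : ℝ) ^ l / (2 * (l : ℝ) + 1) ^ 2 := by
    have h1 : Summable fun l : ℕ => 1 / ((l : ℝ) + 1) ^ 2 := by
      have := (summable_nat_add_iff 1).2 (Real.summable_one_div_nat_pow.2 one_lt_two)
      simpa using this
    refine Summable.of_norm_bounded h1 fun l => ?_
    rw [norm_div, norm_pow, norm_neg, norm_one, one_pow, Real.norm_of_nonneg (by positivity)]
    gcongr
    have : (0 : ℝ) ≤ l := by positivity
    linarith
  have hlim := hsum.hasSum.tendsto_sum_nat
  have hlim2 : Tendsto (fun N : ℕ => ∑ l ∈ Finset.range N, (-1 : ℝ) ^ l / (2 * (l : ℝ) + 1) ^ 2)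
      atTop (𝓝 (-∫ v in (0 : ℝ)..1, Real.log v / (1 + v ^ 2))) := by
    rw [tendsto_iff_norm_sub_tendsto_zero]
    refine squeeze_zero (fun _ => norm_nonneg _) (g := fun N : ℕ => 1 / ((N : ℝ) + 1)) (fun N => ?_)
      tendsto_one_div_add_atTop_nhds_zero_nat
    rw [sub_neg_eq_add, add_comm, Real.norm_eq_abs]
    refine (hpart N).trans ?_
    have : (0 : ℝ) ≤ N := by positivity
    gcongr
    nlinarith
  have := tendsto_nhds_unique hlim hlim2
  rw [catalanConstant]
  linarith

theorem integral_log_one_add_sq :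
    ∫ v in (0 : ℝ)..1, Real.log (1 + v ^ 2) = Real.log 2 - 2 + Real.pi / 2 := by
  have hpos : ∀ v : ℝ, 0 < 1 + v ^ 2 := fun v => by positivity
  have h := intervalIntegral.integral_eq_sub_of_hasDerivAt
    (f := fun v : ℝ => v * Real.log (1 + v ^ 2) - 2 * v + 2 * Real.arctan v)
    (f' := fun v => Real.log (1 + v ^ 2)) (a := 0) (b := 1) ?_ ?_
  · rw [h]; simp [Real.arctan_one]; norm_num; ring
  · intro v _
    have h1 : HasDerivAt (fun v : ℝ => 1 + v ^ 2) (2 * v) v := by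
      simpa using (hasDerivAt_pow 2 v).const_add 1
    have h2 := (((hasDerivAt_id v).mul (h1.log (hpos v).ne')).sub
      ((hasDerivAt_id v).const_mul 2)).add ((Real.hasDerivAt_arctan v).const_mul 2)
    refine h2.congr_deriv ?_
    have := (hpos v).ne'
    simp only [id]
    field_simp
    ring
  · exact (Continuous.log (by fun_prop) fun v => (hpos v).ne').intervalIntegrable _ _

theorem intervalIntegrable_log_sin' (a b : ℝ) :
    IntervalIntegrable (fun x => Real.log (Real.sin x)) MeasureTheory.volume a b :=
  intervalIntegrable_log_sin

theorem intervalIntegrable_log_cos' (a b : ℝ) :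
    IntervalIntegrable (fun x => Real.log (Real.cos x)) MeasureTheory.volume a b :=
  intervalIntegrable_log_cos

/-- Reflection at `π/4` turns the cosine part into the rest of the integral of `log sin` over `[0,
π/2]`. -/
theorem integral_log_sin_add_log_cos :
    (∫ x in (0 : ℝ)..(Real.pi / 4), Real.log (Real.sin x)) +
      ∫ x in (0 : ℝ)..(Real.pi / 4), Real.log (Real.cos x) = -Real.log 2 * Real.pi / 2 := by
  have h1 : ∫ x in (0 : ℝ)..(Real.pi / 4), Real.log (Real.cos x) =
      ∫ x in (Real.pi / 4)..(Real.pi / 2), Real.log (Real.sin x) := by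
    have := intervalIntegral.integral_comp_sub_left (a := 0) (b := Real.pi / 4)
      (fun x => Real.log (Real.sin x)) (Real.pi / 2)
    simp only [Real.sin_pi_div_two_sub, sub_zero] at this
    rw [this]
    congr 1
    ring
  rw [h1, intervalIntegral.integral_add_adjacent_intervals (intervalIntegrable_log_sin' _ _)
    (intervalIntegrable_log_sin' _ _), integral_log_sin_zero_pi_div_two]

theorem integral_comp_arctan (g : ℝ → ℝ) :
    ∫ v in (0 : ℝ)..1, g (Real.arctan v) * (1 / (1 + v ^ 2)) =
      ∫ x in (0 : ℝ)..(Real.pi / 4), g x := by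
  have h := intervalIntegral.integral_comp_mul_deriv_of_deriv_nonneg (a := 0) (b := 1)
    (f := Real.arctan) (f' := fun v => 1 / (1 + v ^ 2)) (g := g)
    Real.continuous_arctan.continuousOn (fun v _ => Real.hasDerivAt_arctan v)
    (fun v _ => by positivity)
  simpa [Real.arctan_one] using h

/-- With `v = tan x` the integrand becomes `-2 log cos x`. The integrals of `log sin` and `log cos`
over `[0, π/4]` have a known sum, and their difference is `∫ log v/(1+v²)`, which is minus Catalan's
constant. -/
theorem integral_log_one_add_sq_div :
    ∫ v in (0 : ℝ)..1, Real.log (1 + v ^ 2) / (1 + v ^ 2) =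
      Real.pi / 2 * Real.log 2 - catalanConstant := by
  have h1 : ∫ v in (0 : ℝ)..1, Real.log (1 + v ^ 2) / (1 + v ^ 2) =
      -2 * ∫ x in (0 : ℝ)..(Real.pi / 4), Real.log (Real.cos x) := by
    rw [← intervalIntegral.integral_const_mul, ← integral_comp_arctan]
    refine intervalIntegral.integral_congr fun v _ => ?_
    have hp : (0 : ℝ) < 1 + v ^ 2 := by positivity
    simp only [Real.cos_arctan]
    rw [Real.log_div one_ne_zero (Real.sqrt_pos.2 hp).ne', Real.log_one, Real.log_sqrt hp.le]
    ring
  have h2 : ∫ v in (0 : ℝ)..1, Real.log v / (1 + v ^ 2) =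
      (∫ x in (0 : ℝ)..(Real.pi / 4), Real.log (Real.sin x)) -
        ∫ x in (0 : ℝ)..(Real.pi / 4), Real.log (Real.cos x) := by
    rw [← intervalIntegral.integral_sub (intervalIntegrable_log_sin' _ _)
      (intervalIntegrable_log_cos' _ _),
      ← integral_comp_arctan]
    refine intervalIntegral.integral_congr_ae (Eventually.of_forall fun v hv => ?_)
    rw [Set.uIoc_of_le zero_le_one] at hv
    have hp : (0 : ℝ) < 1 + v ^ 2 := by positivity
    have hs := (Real.sqrt_pos.2 hp).ne'
    simp only [Real.cos_arctan, Real.sin_arctan]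
    rw [Real.log_div one_ne_zero hs, Real.log_div hv.1.ne' hs, Real.log_one]
    ring
  have h3 := integral_log_sin_add_log_cos
  rw [integral_log_div_one_add_sq] at h2
  rw [h1]
  linarith

/-- Integration by parts leaves `4 ∫ v² log(1+v²)/(1+v²)`, and `v²/(1+v²) = 1 - 1/(1+v²)` reduces
this to the two preceding integrals. -/
theorem integral_log_one_add_sq_sq :
    ∫ v in (0 : ℝ)..1, Real.log (1 + v ^ 2) ^ 2 =
      Real.log 2 ^ 2 - 4 * (Real.log 2 - 2 + Real.pi / 2) +
        4 * (Real.pi / 2 * Real.log 2 - catalanConstant) := by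
  have hpos : ∀ v : ℝ, 0 < 1 + v ^ 2 := fun v => by positivity
  have hc : Continuous fun v : ℝ => Real.log (1 + v ^ 2) :=
    Continuous.log (by fun_prop) fun v => (hpos v).ne'
  have hc2 : Continuous fun v : ℝ => Real.log (1 + v ^ 2) / (1 + v ^ 2) :=
    hc.div (by fun_prop) fun v => (hpos v).ne'
  have h := intervalIntegral.integral_eq_sub_of_hasDerivAt
    (f := fun v : ℝ => v * Real.log (1 + v ^ 2) ^ 2 -
      4 * (v * Real.log (1 + v ^ 2) - 2 * v + 2 * Real.arctan v))
    (f' := fun v => Real.log (1 + v ^ 2) ^ 2 - 4 * (Real.log (1 + v ^ 2) / (1 + v ^ 2)))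
    (a := 0) (b := 1) ?_ ?_
  · rw [intervalIntegral.integral_sub (Continuous.intervalIntegrable (by fun_prop) _ _)
      (Continuous.intervalIntegrable (by fun_prop) _ _), intervalIntegral.integral_const_mul,
      integral_log_one_add_sq_div] at h
    simp only [Real.arctan_one, Real.arctan_zero] at h
    norm_num at h
    linarith
  · intro v _
    have h1 : HasDerivAt (fun v : ℝ => 1 + v ^ 2) (2 * v) v := by
      simpa using (hasDerivAt_pow 2 v).const_add 1
    have hl := h1.log (hpos v).ne'
    have h2 := ((hasDerivAt_id v).mul (hl.pow 2)).sub (((((hasDerivAt_id v).mul hl).sub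
      ((hasDerivAt_id v).const_mul 2)).add ((Real.hasDerivAt_arctan v).const_mul 2)).const_mul 4)
    refine h2.congr_deriv ?_
    have := (hpos v).ne'
    simp only [id, Pi.pow_apply]
    field_simp
    ring
  · exact ((hc.pow 2).sub (hc2.const_mul 4)).intervalIntegrable _ _

theorem integral_comp_two_mul_sub_one_of_even {f : ℝ → ℝ} (hf : Continuous f)
    (heven : ∀ x, f (-x) = f x) :
    ∫ u in (0 : ℝ)..1, f (2 * u - 1) = ∫ v in (0 : ℝ)..1, f v := by
  rw [intervalIntegral.integral_comp_mul_sub f two_ne_zero]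
  norm_num
  rw [← intervalIntegral.integral_add_adjacent_intervals (hf.intervalIntegrable (-1) 0)
    (hf.intervalIntegrable 0 1)]
  have h := intervalIntegral.integral_comp_neg (a := 0) (b := 1) f
  simp only [heven, neg_zero] at h
  rw [← h]
  ring

theorem continuous_agreeProb : Continuous agreeProb := by
  unfold agreeProb; fun_prop

theorem continuous_log_agreeProb : Continuous fun u => Real.log (agreeProb u) :=
  continuous_agreeProb.log fun u => (agreeProb_pos u).ne'

/-- Centering at `1/2` makes the function even in `2u - 1`, which reduces the moments to integrals
of `log(1+v²)` over `[0,1]`. -/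
theorem log_agreeProb (u : ℝ) :
    Real.log (agreeProb u) = Real.log (1 + (2 * u - 1) ^ 2) - Real.log 2 := by
  rw [← Real.log_div (by positivity) two_ne_zero]
  congr 1
  unfold agreeProb
  ring

theorem integral_log_agreeProb :
    ∫ u in (0 : ℝ)..1, Real.log (agreeProb u) = Real.pi / 2 - 2 := by
  have hc : Continuous fun v : ℝ => Real.log (1 + v ^ 2) :=
    Continuous.log (by fun_prop) fun v => by positivity
  simp_rw [log_agreeProb]
  rw [integral_comp_two_mul_sub_one_of_even (f := fun v => Real.log (1 + v ^ 2) - Real.log 2)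
    (by fun_prop) (by simp), intervalIntegral.integral_sub (hc.intervalIntegrable _ _) (by simp),
    integral_log_one_add_sq]
  simp
  ring

theorem integral_log_agreeProb_sq :
    ∫ u in (0 : ℝ)..1, Real.log (agreeProb u) ^ 2 =
      8 + Real.pi * Real.log 2 - 4 * catalanConstant - 2 * Real.pi := by
  have hc : Continuous fun v : ℝ => Real.log (1 + v ^ 2) :=
    Continuous.log (by fun_prop) fun v => by positivity
  simp_rw [log_agreeProb]
  rw [integral_comp_two_mul_sub_one_of_even
    (f := fun v => (Real.log (1 + v ^ 2) - Real.log 2) ^ 2) (by fun_prop) (by simp)]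
  have e : ∀ v : ℝ, (Real.log (1 + v ^ 2) - Real.log 2) ^ 2 =
      Real.log (1 + v ^ 2) ^ 2 - 2 * Real.log 2 * Real.log (1 + v ^ 2) + Real.log 2 ^ 2 :=
    fun v => by ring
  simp_rw [e]
  rw [intervalIntegral.integral_add (Continuous.intervalIntegrable (by fun_prop) _ _) (by simp),
    intervalIntegral.integral_sub (Continuous.intervalIntegrable (by fun_prop) _ _)
      (Continuous.intervalIntegrable (by fun_prop) _ _),
    intervalIntegral.integral_const_mul, integral_log_one_add_sq, integral_log_one_add_sq_sq]
  simp
  ring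

theorem integral_sub_mean_sq :
    ∫ u in (0 : ℝ)..1, (Real.log (agreeProb u) - (Real.pi / 2 - 2)) ^ 2 =
      4 + Real.pi * Real.log 2 - 4 * catalanConstant - Real.pi ^ 2 / 4 := by
  have hc := continuous_log_agreeProb
  have e : ∀ u : ℝ, (Real.log (agreeProb u) - (Real.pi / 2 - 2)) ^ 2 =
      Real.log (agreeProb u) ^ 2 - 2 * (Real.pi / 2 - 2) * Real.log (agreeProb u) +
        (Real.pi / 2 - 2) ^ 2 := fun v => by ring
  simp_rw [e]
  rw [intervalIntegral.integral_add (Continuous.intervalIntegrable (by fun_prop) _ _) (by simp),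
    intervalIntegral.integral_sub (Continuous.intervalIntegrable (by fun_prop) _ _)
      (Continuous.intervalIntegrable (by fun_prop) _ _),
    intervalIntegral.integral_const_mul, integral_log_agreeProb, integral_log_agreeProb_sq]
  simp
  ring

/-- The variance of `log (agreeProb u)` for uniform `u` is positive. -/
theorem variance_constant_pos :
    0 < 4 + Real.pi * Real.log 2 - 4 * catalanConstant - Real.pi ^ 2 / 4 := by
  have hc := continuous_log_agreeProb
  rw [← integral_sub_mean_sq]
  refine intervalIntegral.integral_pos zero_lt_one
    (Continuous.continuousOn (by fun_prop)) (fun _ _ => sq_nonneg _)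
    -- At `u = 0` the logarithm is `0`, while the mean `π/2 - 2` is negative.
    ⟨0, by simp, ?_⟩
  have h0 : agreeProb 0 = 1 := by simp [agreeProb]
  rw [h0, Real.log_one]
  have := Real.pi_lt_four
  have : Real.pi / 2 - 2 < 0 := by linarith
  nlinarith

/-! ### Central limit theorem at moving thresholds -/

theorem MeasureTheory.TendstoInDistribution.comp_tendsto {Ω Ω' : Type*} {mΩ : MeasurableSpace Ω}
    {mΩ' : MeasurableSpace Ω'} {P : MeasureTheory.Measure Ω} {P' : MeasureTheory.Measure Ω'}
    [MeasureTheory.IsProbabilityMeasure P] [MeasureTheory.IsProbabilityMeasure P']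
    {X : ℕ → Ω → ℝ} {Z : Ω' → ℝ}
    (h : MeasureTheory.TendstoInDistribution X atTop Z (fun _ => P) P')
    {t : ℕ → ℕ} (ht : Tendsto t atTop atTop) :
    MeasureTheory.TendstoInDistribution (fun n => X (t n)) atTop Z (fun _ => P) P' where
  forall_aemeasurable n := h.forall_aemeasurable (t n)
  aemeasurable_limit := h.aemeasurable_limit
  tendsto := h.tendsto.comp ht

/-- Convergence in distribution gives convergence of distribution functions along convergent
arguments. -/
theorem MeasureTheory.TendstoInDistribution.tendsto_measureReal_le {Ω Ω' : Type*}
    {mΩ : MeasurableSpace Ω} {mΩ' : MeasurableSpace Ω'} {P : MeasureTheory.Measure Ω}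
    {P' : MeasureTheory.Measure Ω'} [MeasureTheory.IsProbabilityMeasure P]
    [MeasureTheory.IsProbabilityMeasure P'] {X : ℕ → Ω → ℝ} {Z : Ω' → ℝ}
    (h : MeasureTheory.TendstoInDistribution X atTop Z (fun _ => P) P')
    {x : ℕ → ℝ} {c : ℝ} (hx : Tendsto x atTop (𝓝 c)) (hc : P' {ω | Z ω = c} = 0) :
    Tendsto (fun n => P.real {ω | X n ω ≤ x n}) atTop (𝓝 (P'.real {ω | Z ω ≤ c})) := by
  -- Slutsky's argument: the threshold `x n` is subtracted as a deterministic variable, so that the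
  -- fixed set `Iic 0` can be used; its frontier is null in the limit by `hc`.
  have hy : MeasureTheory.TendstoInMeasure P (fun n (_ : Ω) => -x n) atTop (fun _ => -c) :=
    MeasureTheory.tendstoInMeasure_of_tendsto_ae (fun _ => MeasureTheory.aestronglyMeasurable_const)
      (Eventually.of_forall fun _ => hx.neg)
  have h1 := h.add_of_tendstoInMeasure_const hy (fun _ => aemeasurable_const)
  have h2 := MeasureTheory.ProbabilityMeasure.tendsto_measure_of_null_frontier_of_tendsto'
    h1.tendsto (E := Set.Iic 0) ?_
  · have e1 : ∀ n, (P.map (X n + fun _ => -x n)) (Set.Iic 0) = P {ω | X n ω ≤ x n} := by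
      intro n
      rw [MeasureTheory.Measure.map_apply_of_aemeasurable (h1.forall_aemeasurable n)
        measurableSet_Iic]
      congr 1
      ext ω
      simp
    have e2 : (P'.map (fun ω => Z ω + -c)) (Set.Iic 0) = P' {ω | Z ω ≤ c} := by
      rw [MeasureTheory.Measure.map_apply_of_aemeasurable h1.aemeasurable_limit
        measurableSet_Iic]
      congr 1
      ext ω
      simp
    simp only [MeasureTheory.ProbabilityMeasure.coe_mk, e1, e2] at h2
    exact (ENNReal.tendsto_toReal (MeasureTheory.measure_ne_top _ _)).comp h2
  · simp only [MeasureTheory.ProbabilityMeasure.coe_mk]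
    rw [frontier_Iic, MeasureTheory.Measure.map_apply_of_aemeasurable h1.aemeasurable_limit
        (measurableSet_singleton _)]
    convert hc using 2
    ext ω
    simp [add_neg_eq_zero]

/-- The uniform distribution on the unit interval. -/
noncomputable def unitUniform : MeasureTheory.Measure ℝ := MeasureTheory.volume.restrict (Set.Ioc 0 1)

instance : MeasureTheory.IsProbabilityMeasure unitUniform :=
  ⟨by simp [unitUniform]⟩

/-- The law of a sequence of independent uniform random variables. -/
noncomputable def uniformSequence : MeasureTheory.Measure (ℕ → ℝ) :=
  MeasureTheory.Measure.infinitePi fun _ => unitUniform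

instance : MeasureTheory.IsProbabilityMeasure uniformSequence := by
  unfold uniformSequence; infer_instance

theorem integral_unitUniform (f : ℝ → ℝ) : ∫ u, f u ∂unitUniform = ∫ u in (0 : ℝ)..1, f u := by
  rw [intervalIntegral.integral_of_le zero_le_one, unitUniform]

/-- The variance of `log (agreeProb u)` for uniform `u`. -/
noncomputable def logAgreeVar : ℝ :=
  4 + Real.pi * Real.log 2 - 4 * catalanConstant - Real.pi ^ 2 / 4

/-- `log (agreeProb u)` standardized to mean zero and variance one. -/
noncomputable def stdLogAgree (u : ℝ) : ℝ :=
  (Real.log (agreeProb u) - (Real.pi / 2 - 2)) / Real.sqrt logAgreeVar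

theorem continuous_stdLogAgree : Continuous stdLogAgree := by
  have := continuous_log_agreeProb
  unfold stdLogAgree
  fun_prop

theorem integral_stdLogAgree : ∫ u in (0 : ℝ)..1, stdLogAgree u = 0 := by
  have hc := continuous_log_agreeProb
  unfold stdLogAgree
  rw [intervalIntegral.integral_div, intervalIntegral.integral_sub (hc.intervalIntegrable _ _)
    (by simp), integral_log_agreeProb]
  simp

theorem integral_stdLogAgree_sq : ∫ u in (0 : ℝ)..1, stdLogAgree u ^ 2 = 1 := by
  have hv : 0 < logAgreeVar := variance_constant_pos
  simp only [stdLogAgree, div_pow]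
  rw [intervalIntegral.integral_div, Real.sq_sqrt hv.le, integral_sub_mean_sq]
  exact div_self hv.ne'

theorem tendstoInDistribution_stdLogAgree :
    MeasureTheory.TendstoInDistribution
      (fun (t : ℕ) (ω : ℕ → ℝ) => (Real.sqrt t)⁻¹ * ∑ s ∈ Finset.range t, stdLogAgree (ω s))
      atTop id (fun _ => uniformSequence) (ProbabilityTheory.gaussianReal 0 1) := by
  have hm : Measurable stdLogAgree := continuous_stdLogAgree.measurable
  have heval : ∀ i, MeasureTheory.MeasurePreserving (Function.eval i) uniformSequence unitUniform :=
    fun i => measurePreserving_eval_infinitePi (fun _ : ℕ => unitUniform) i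
  have hint : ∀ f : ℝ → ℝ, Measurable f →
      ∫ ω, f (ω 0) ∂uniformSequence = ∫ u in (0 : ℝ)..1, f u := by
    intro f hf
    rw [← integral_unitUniform, ← (heval 0).map_eq,
      MeasureTheory.integral_map (heval 0).measurable.aemeasurable hf.aestronglyMeasurable]
  refine ProbabilityTheory.tendstoInDistribution_inv_sqrt_mul_sum
    (X := fun s (ω : ℕ → ℝ) => stdLogAgree (ω s)) ProbabilityTheory.HasLaw.id ?_ ?_ ?_ ?_
  · rw [hint _ hm, integral_stdLogAgree]
  · exact (hint _ (hm.pow_const 2)).trans integral_stdLogAgree_sq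
  · exact ProbabilityTheory.iIndepFun_infinitePi (fun _ => hm)
  · intro i
    refine ⟨(hm.comp (heval i).measurable).aemeasurable, (hm.comp (heval 0).measurable).aemeasurable, ?_⟩
    have h : ∀ i, uniformSequence.map (fun ω => stdLogAgree (ω i)) =
        unitUniform.map stdLogAgree := by
      intro i
      rw [← (heval i).map_eq, MeasureTheory.Measure.map_map hm (heval i).measurable]
      rfl
    rw [h, h]

/-- Central limit theorem for sums of `log (agreeProb u)`, along a sequence of times. -/
theorem tendsto_measureReal_sum_log_agreeProb_le {t : ℕ → ℕ} (ht : Tendsto t atTop atTop)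
    {m : ℕ → ℝ} {c : ℝ}
    (hm : Tendsto (fun n => (m n - t n * (Real.pi / 2 - 2)) /
      (Real.sqrt logAgreeVar * Real.sqrt (t n))) atTop (𝓝 c)) :
    Tendsto (fun n => uniformSequence.real
      {ω | ∑ s ∈ Finset.range (t n), Real.log (agreeProb (ω s)) ≤ m n}) atTop
      (𝓝 (normalCDF c)) := by
  have h := (tendstoInDistribution_stdLogAgree.comp_tendsto ht).tendsto_measureReal_le hm (by
    have := ProbabilityTheory.nullSingletonClass_gaussianReal (μ := 0) (v := 1) one_ne_zero
    exact MeasureTheory.measure_singleton c)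
  have hlim : (ProbabilityTheory.gaussianReal 0 1).real {ω | id ω ≤ c} = normalCDF c := by
    rw [normalCDF, ProbabilityTheory.cdf_eq_real]
    rfl
  rw [hlim] at h
  refine h.congr' ?_
  filter_upwards [ht.eventually_gt_atTop 0] with n hn
  congr 1
  ext ω
  have hv := Real.sqrt_pos.2 variance_constant_pos
  change 0 < Real.sqrt logAgreeVar at hv
  have hs : 0 < Real.sqrt (t n) := Real.sqrt_pos.2 (by exact_mod_cast hn)
  simp only [Set.mem_ofPred_eq, stdLogAgree]
  rw [← Finset.sum_div, Finset.sum_sub_distrib]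
  simp only [Finset.sum_const, Finset.card_range, nsmul_eq_mul]
  rw [inv_mul_eq_div, div_div, div_le_div_iff_of_pos_right (by positivity), sub_le_sub_iff_right]

/-! ### Pile sizes generated from uniform variables -/

/-- The constant is the Lipschitz bound `2` for `agreeProb` on `[0,1]` divided by its lower bound
`1/2`. -/
theorem abs_log_agreeProb_sub_le {u v : ℝ} (hu : u ∈ Set.Icc 0 1) (hv : v ∈ Set.Icc 0 1) :
    |Real.log (agreeProb u) - Real.log (agreeProb v)| ≤ 4 * |u - v| := by
  have key : ∀ u v : ℝ, u ∈ Set.Icc (0 : ℝ) 1 → v ∈ Set.Icc (0 : ℝ) 1 →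
      Real.log (agreeProb u) - Real.log (agreeProb v) ≤ 4 * |u - v| := by
    intro u v hu hv
    have h1 := half_le_agreeProb v
    have h2 : agreeProb u - agreeProb v ≤ 2 * |u - v| := by
      have e : agreeProb u - agreeProb v = 2 * ((u - v) * (u + v - 1)) := by
        unfold agreeProb; ring
      rw [e]
      have h3 : |u + v - 1| ≤ 1 := by
        rw [abs_le]; constructor <;> linarith [hu.1, hu.2, hv.1, hv.2]
      have h4 : (u - v) * (u + v - 1) ≤ |u - v| :=
        (le_abs_self _).trans (by rw [abs_mul]; exact mul_le_of_le_one_right (abs_nonneg _) h3)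
      linarith
    rw [← Real.log_div (agreeProb_pos u).ne' (agreeProb_pos v).ne']
    refine (Real.log_le_sub_one_of_pos (div_pos (agreeProb_pos u) (agreeProb_pos v))).trans ?_
    rw [div_sub_one (agreeProb_pos v).ne', div_le_iff₀ (agreeProb_pos v)]
    nlinarith [abs_nonneg (u - v)]
  rw [abs_le]
  constructor
  · have := key v u hv hu
    rw [abs_sub_comm] at this
    linarith
  · exact key u v hu hv

/-- The size of the pile determined by a uniform random variable. -/
noncomputable def pileSize (n : ℕ) (u : ℝ) : ℕ := ⌈(n : ℝ) * u⌉₊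

theorem measurable_pileSize (n : ℕ) : Measurable (pileSize n) :=
  Nat.measurable_ceil.comp (measurable_const.mul measurable_id)

theorem pileSize_le {n : ℕ} {u : ℝ} (hu : u ∈ Set.Ioc (0 : ℝ) 1) : pileSize n u ≤ n :=
  Nat.ceil_le.2 (mul_le_of_le_one_right (by positivity) hu.2)

theorem pileSize_pos {n : ℕ} (hn : 0 < n) {u : ℝ} (hu : u ∈ Set.Ioc (0 : ℝ) 1) :
    0 < pileSize n u :=
  Nat.ceil_pos.2 (mul_pos (by exact_mod_cast hn) hu.1)

theorem abs_pileSize_div_sub_le {n : ℕ} (hn : 0 < n) {u : ℝ} (hu : u ∈ Set.Ioc (0 : ℝ) 1) :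
    |(pileSize n u : ℝ) / n - u| ≤ 1 / n := by
  have hn' : (0 : ℝ) < n := by exact_mod_cast hn
  have h1 : (n : ℝ) * u ≤ pileSize n u := Nat.le_ceil _
  have h2 : (pileSize n u : ℝ) < n * u + 1 := Nat.ceil_lt_add_one (by have := hu.1; positivity)
  rw [abs_le]
  constructor
  · have : u ≤ (pileSize n u : ℝ) / n := by rw [le_div_iff₀ hn']; linarith
    have : 0 ≤ 1 / (n : ℝ) := by positivity
    linarith
  · rw [sub_le_iff_le_add, div_le_iff₀ hn', add_mul, one_div_mul_cancel hn'.ne']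
    linarith

/-- The ceiling equals `k + 1` exactly on an interval of length `1/n` open on the left, which is why
the uniform law lives on `(0,1]`. -/
theorem unitUniform_pileSize_eq {n : ℕ} (k : Fin n) :
    unitUniform {u | pileSize n u = k + 1} = ENNReal.ofReal (1 / n) := by
  have hn : (0 : ℝ) < n := by exact_mod_cast k.pos
  have hk : ((k : ℕ) : ℝ) + 1 ≤ n := by exact_mod_cast k.2
  have hm : MeasurableSet {u | pileSize n u = k + 1} :=
    measurable_pileSize n (measurableSet_singleton _)
  rw [unitUniform, MeasureTheory.Measure.restrict_apply hm]
  have : {u | pileSize n u = k + 1} ∩ Set.Ioc 0 1 =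
      Set.Ioc (((k : ℕ) : ℝ) / n) ((((k : ℕ) : ℝ) + 1) / n) := by
    ext u
    simp only [pileSize, Set.mem_inter_iff, Set.mem_ofPred_eq, Set.mem_Ioc]
    rw [Nat.ceil_eq_iff (by omega), div_lt_iff₀ hn, le_div_iff₀ hn]
    push_cast
    have hk0 : (0 : ℝ) ≤ ((k : ℕ) : ℝ) := by positivity
    constructor
    · rintro ⟨⟨h1, h2⟩, -⟩
      constructor <;> linarith
    · rintro ⟨h1, h2⟩
      refine ⟨⟨by linarith, by linarith⟩, ?_, ?_⟩
      · by_contra h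
        nlinarith
      · by_contra h
        nlinarith
  rw [this, Real.volume_Ioc]
  congr 1
  ring

theorem ae_mem_Ioc_uniformSequence : ∀ᵐ ω ∂uniformSequence, ∀ s, ω s ∈ Set.Ioc (0 : ℝ) 1 := by
  rw [MeasureTheory.ae_all_iff]
  intro s
  have h := measurePreserving_eval_infinitePi (fun _ : ℕ => unitUniform) s
  have h1 : ∀ᵐ u ∂unitUniform, u ∈ Set.Ioc (0 : ℝ) 1 :=
    MeasureTheory.ae_restrict_mem measurableSet_Ioc
  exact h.quasiMeasurePreserving.ae h1

theorem uniformSequence_pileSize_eq {n t : ℕ} (K : Fin t → Fin n) :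
    uniformSequence.real {ω | ∀ s : Fin t, pileSize n (ω s) = K s + 1} = (1 / (n : ℝ)) ^ t := by
  classical
  have h : {ω : ℕ → ℝ | ∀ s : Fin t, pileSize n (ω s) = K s + 1} =
      Set.pi (Finset.range t) fun i =>
        if hi : i < t then {u | pileSize n u = K ⟨i, hi⟩ + 1} else Set.univ := by
    ext ω
    simp only [Set.mem_ofPred_eq, Set.mem_pi, Finset.coe_range, Set.mem_Iio]
    constructor
    · intro h i hi
      rw [dif_pos hi]
      exact h ⟨i, hi⟩
    · intro h s
      have := h s s.2
      rwa [dif_pos s.2] at this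
  rw [h, MeasureTheory.measureReal_def, uniformSequence, MeasureTheory.Measure.infinitePi_pi]
  · rw [Finset.prod_congr rfl (g := fun _ => ENNReal.ofReal (1 / n))]
    · rw [Finset.prod_const, Finset.card_range, ENNReal.toReal_pow,
        ENNReal.toReal_ofReal (by positivity)]
    · intro i hi
      rw [dif_pos (Finset.mem_range.1 hi), unitUniform_pileSize_eq]
  · intro i _
    split_ifs with hi
    · exact measurable_pileSize n (measurableSet_singleton _)
    · exact MeasurableSet.univ

theorem measurable_distinctProbGiven_pileSize (n t : ℕ) :
    Measurable fun ω : ℕ → ℝ => distinctProbGiven n fun s : Fin t => pileSize n (ω s) :=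
  (measurable_of_countable (distinctProbGiven n (t := t))).comp
    (measurable_pi_lambda _ fun _ => (measurable_pileSize n).comp (measurable_pi_apply _))

theorem integrable_distinctProbGiven_pileSize (n t : ℕ) :
    MeasureTheory.Integrable (fun ω : ℕ → ℝ =>
      distinctProbGiven n fun s : Fin t => pileSize n (ω s)) uniformSequence := by
  refine MeasureTheory.Integrable.of_bound
    (measurable_distinctProbGiven_pileSize n t).aestronglyMeasurable 1 ?_
  filter_upwards [ae_mem_Ioc_uniformSequence] with ω hω
  rw [Real.norm_of_nonneg (distinctProbGiven_nonneg _)]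
  exact distinctProbGiven_le_one fun s => pileSize_le (hω s)

/-- Pile sizes can be generated from independent uniform random variables. -/
theorem distinctProb_eq_integral {n : ℕ} (hn : 0 < n) (t : ℕ) :
    distinctProb n t = ∫ ω, (distinctProbGiven n fun s : Fin t => pileSize n (ω s))
      ∂uniformSequence := by
  have hmeas : ∀ K : Fin t → Fin n,
      MeasurableSet {ω : ℕ → ℝ | ∀ s : Fin t, pileSize n (ω s) = K s + 1} := by
    intro K
    rw [Set.ofPred_forall]
    exact MeasurableSet.iInter fun _ => ((measurable_pileSize n).comp (measurable_pi_apply _))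
      (measurableSet_singleton _)
  -- Almost surely exactly one sequence `K` of sizes occurs, so the integrand is a finite sum of
  -- indicators.
  have h : (fun ω : ℕ → ℝ => distinctProbGiven n fun s : Fin t => pileSize n (ω s))
      =ᵐ[uniformSequence] fun ω => ∑ K : Fin t → Fin n,
        {ω : ℕ → ℝ | ∀ s : Fin t, pileSize n (ω s) = K s + 1}.indicator
          (fun _ => distinctProbGiven n fun s => (K s : ℕ) + 1) ω := by
    filter_upwards [ae_mem_Ioc_uniformSequence] with ω hω
    have hlt : ∀ s : Fin t, pileSize n (ω s) - 1 < n := fun s => by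
      have := pileSize_le (n := n) (hω s)
      omega
    have heq : ∀ s : Fin t, pileSize n (ω s) - 1 + 1 = pileSize n (ω s) := fun s =>
      Nat.sub_add_cancel (pileSize_pos hn (hω s))
    rw [Finset.sum_eq_single (fun s => ⟨pileSize n (ω s) - 1, hlt s⟩)]
    · rw [Set.indicator_of_mem]
      · simp only [heq]
      · intro s
        simp only [heq]
    · intro K _ hK
      refine Set.indicator_of_notMem (fun hmem => hK ?_) _
      funext s
      apply Fin.ext
      have := hmem s
      simp [this]
    · simp
  rw [MeasureTheory.integral_congr_ae h, MeasureTheory.integral_finsetSum _ fun K _ =>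
    (MeasureTheory.integrable_const _).indicator (hmeas K), distinctProb_eq_sum, Finset.mul_sum]
  refine Finset.sum_congr rfl fun K _ => ?_
  rw [MeasureTheory.integral_indicator_const _ (hmeas K), uniformSequence_pileSize_eq, smul_eq_mul]

/-- Each rounding moves the argument by at most `1/n`, and the Lipschitz constant is `4`. -/
theorem abs_log_agreeProd_sub_le {n t : ℕ} (hn : 0 < n) {ω : ℕ → ℝ}
    (hω : ∀ s, ω s ∈ Set.Ioc (0 : ℝ) 1) :
    |Real.log (agreeProd n fun s : Fin t => pileSize n (ω s)) -
      ∑ s ∈ Finset.range t, Real.log (agreeProb (ω s))| ≤ 4 * t / n := by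
  rw [agreeProd, Real.log_prod fun s _ => (agreeProb_pos _).ne',
    ← Fin.sum_univ_eq_sum_range (fun s => Real.log (agreeProb (ω s))), ← Finset.sum_sub_distrib]
  have h : ∀ s : Fin t, |Real.log (agreeProb ((pileSize n (ω s) : ℝ) / n)) -
      Real.log (agreeProb (ω s))| ≤ 4 / n := by
    intro s
    refine (abs_log_agreeProb_sub_le ⟨by positivity, div_le_one_of_le₀
      (by exact_mod_cast pileSize_le (hω s)) (by positivity)⟩ ⟨(hω s).1.le, (hω s).2⟩).trans ?_
    have := abs_pileSize_div_sub_le hn (hω s)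
    calc _ ≤ 4 * (1 / (n : ℝ)) := by gcongr
      _ = _ := by ring
  refine (Finset.abs_sum_le_sum_abs _ _).trans ((Finset.sum_le_sum fun s _ => h s).trans_eq ?_)
  simp
  ring

/-! ### Comparison with the random walk and vanishing errors -/

theorem measurableSet_sum_log_agreeProb_le (t : ℕ) (m : ℝ) :
    MeasurableSet {ω : ℕ → ℝ | ∑ s ∈ Finset.range t, Real.log (agreeProb (ω s)) ≤ m} := by
  refine measurableSet_le (Finset.measurable_sum _ fun s _ => ?_) measurable_const
  exact continuous_log_agreeProb.measurable.comp (measurable_pi_apply s)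

/-- On the event, `n² R` is at most `exp(4t/n - M)` and the first moment bound applies; off the
event `0` is enough. -/
theorem le_distinctProb {n : ℕ} (hn : 4 ≤ n) (t : ℕ) (M : ℝ) :
    (1 - replacementFactor n ^ t * Real.exp (4 * t / n - M)) * uniformSequence.real
      {ω | ∑ s ∈ Finset.range t, Real.log (agreeProb (ω s)) ≤ -2 * Real.log n - M} ≤
      distinctProb n t := by
  have hn0 : 0 < n := by omega
  have hm := measurableSet_sum_log_agreeProb_le t (-2 * Real.log n - M)
  rw [distinctProb_eq_integral hn0, mul_comm, ← smul_eq_mul,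
    ← MeasureTheory.integral_indicator_const _ hm]
  refine MeasureTheory.integral_mono_ae ((MeasureTheory.integrable_const _).indicator hm)
    (integrable_distinctProbGiven_pileSize n t) ?_
  filter_upwards [ae_mem_Ioc_uniformSequence] with ω hω
  refine Set.indicator_apply_le' (fun hA => ?_) fun _ => distinctProbGiven_nonneg _
  refine le_trans ?_ (one_sub_le_distinctProbGiven hn fun s => pileSize_le (hω s))
  have hR := agreeProd_pos n fun s : Fin t => pileSize n (ω s)
  have h1 := (abs_le.1 (abs_log_agreeProd_sub_le (t := t) hn0 hω)).2
  have hn' : (0 : ℝ) < n := by exact_mod_cast hn0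
  have h2 : (n : ℝ) ^ 2 * agreeProd n (fun s : Fin t => pileSize n (ω s)) ≤
      Real.exp (4 * t / n - M) := by
    rw [← Real.log_le_iff_le_exp (by positivity), Real.log_mul (by positivity) hR.ne', Real.log_pow]
    have : ∑ s ∈ Finset.range t, Real.log (agreeProb (ω s)) ≤ -2 * Real.log n - M := hA
    push_cast
    linarith
  have := pow_nonneg (replacementFactor_nonneg n) t
  gcongr

/-- The error term of the second moment bound. -/
noncomputable def secondMomentError (n t : ℕ) (y : ℝ) : ℝ :=
  replacementFactor n ^ t / ((1 - 1 / (n : ℝ)) * (1 - 2 / (n : ℝ)) ^ t) ^ 2 *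
    (1 + 4 / Real.sqrt y + 2 / y) - 1

/-- On the event the trivial bound `1` is used. Off it, `n² R` is at least `exp(M - 4t/n)`, and the
second moment bound decreases in this quantity. The absolute value keeps the error term nonnegative
on the event too. -/
theorem distinctProb_le {n : ℕ} (hn : 4 ≤ n) (t : ℕ) (M : ℝ) :
    distinctProb n t ≤ uniformSequence.real
      {ω | ∑ s ∈ Finset.range t, Real.log (agreeProb (ω s)) ≤ -2 * Real.log n + M} +
      |secondMomentError n t (Real.exp (M - 4 * t / n))| := by
  have hn0 : 0 < n := by omega
  have hm := measurableSet_sum_log_agreeProb_le t (-2 * Real.log n + M)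
  set A := {ω : ℕ → ℝ | ∑ s ∈ Finset.range t, Real.log (agreeProb (ω s)) ≤ -2 * Real.log n + M}
    with hA
  set δ := |secondMomentError n t (Real.exp (M - 4 * t / n))| with hδ
  have e : uniformSequence.real A + δ = ∫ ω, (A.indicator (fun _ => (1 : ℝ)) ω + δ)
      ∂uniformSequence := by
    rw [MeasureTheory.integral_add ((MeasureTheory.integrable_const _).indicator hm)
      (MeasureTheory.integrable_const _), MeasureTheory.integral_indicator_const _ hm]
    simp
  rw [distinctProb_eq_integral hn0, e]
  refine MeasureTheory.integral_mono_ae (integrable_distinctProbGiven_pileSize n t)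
    (((MeasureTheory.integrable_const _).indicator hm).add (MeasureTheory.integrable_const _)) ?_
  filter_upwards [ae_mem_Ioc_uniformSequence] with ω hω
  have hK : ∀ s : Fin t, pileSize n (ω s) ≤ n := fun s => pileSize_le (hω s)
  by_cases hωA : ω ∈ A
  · rw [Set.indicator_of_mem hωA]
    have := distinctProbGiven_le_one hK
    have : 0 ≤ δ := abs_nonneg _
    linarith
  · rw [Set.indicator_of_notMem hωA, zero_add]
    refine (distinctProbGiven_le hn hK).trans (le_trans ?_ (le_abs_self _))
    have hR := agreeProd_pos n fun s : Fin t => pileSize n (ω s)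
    have h1 := (abs_le.1 (abs_log_agreeProd_sub_le (t := t) hn0 hω)).1
    have hn' : (0 : ℝ) < n := by exact_mod_cast hn0
    have h2 : Real.exp (M - 4 * t / n) ≤
        (n : ℝ) ^ 2 * agreeProd n (fun s : Fin t => pileSize n (ω s)) := by
      rw [← Real.le_log_iff_exp_le (by positivity), Real.log_mul (by positivity) hR.ne',
        Real.log_pow]
      have : ¬ ∑ s ∈ Finset.range t, Real.log (agreeProb (ω s)) ≤ -2 * Real.log n + M := hωA
      push_cast
      linarith
    unfold secondMomentError
    have h3 := pow_nonneg (replacementFactor_nonneg n) t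
    have h4 := Real.exp_pos (M - 4 * t / n)
    have h5 := Real.sqrt_pos.2 h4
    gcongr

/-- Bernoulli's inequality bounds the power below by `1 - x t/n`. -/
theorem tendsto_one_sub_div_pow {t : ℕ → ℕ} (ht : Tendsto (fun n : ℕ => (t n : ℝ) / n) atTop (𝓝 0))
    {x : ℝ} (hx : 0 ≤ x) : Tendsto (fun n : ℕ => (1 - x / (n : ℝ)) ^ t n) atTop (𝓝 1) := by
  have h1 : Tendsto (fun n : ℕ => 1 - x * ((t n : ℝ) / n)) atTop (𝓝 1) := by
    simpa using (ht.const_mul x).const_sub 1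
  have h2 : ∀ᶠ n : ℕ in atTop, x / (n : ℝ) ≤ 1 := by
    filter_upwards [eventually_ge_atTop ⌈x⌉₊, eventually_gt_atTop 0] with n hn hn0
    exact div_le_one_of_le₀ (Nat.ceil_le.1 hn) (by positivity)
  refine tendsto_of_tendsto_of_tendsto_of_le_of_le' h1 tendsto_const_nhds ?_ ?_
  · filter_upwards [h2] with n hn
    have := one_add_mul_le_pow (a := -(x / (n : ℝ))) (by linarith) (t n)
    calc 1 - x * ((t n : ℝ) / n) = 1 + (t n : ℝ) * -(x / n) := by ring
      _ ≤ _ := this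
  · filter_upwards [h2] with n hn
    exact pow_le_one₀ (by linarith) (by linarith [show 0 ≤ x / (n : ℝ) by positivity])

theorem one_le_replacementFactor {n : ℕ} (hn : 4 ≤ n) : 1 ≤ replacementFactor n := by
  have : (0 : ℝ) < n.descFactorial 4 := by exact_mod_cast Nat.descFactorial_pos.2 hn
  rw [replacementFactor, one_le_div this]
  exact_mod_cast Nat.descFactorial_le_pow n 4

theorem replacementFactor_le {n : ℕ} (hn : 4 ≤ n) :
    replacementFactor n ≤ ((1 - 3 / (n : ℝ)) ^ 4)⁻¹ := by
  have hn' : (4 : ℝ) ≤ n := by exact_mod_cast hn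
  have h1 : ((n : ℝ) - 3) ^ 4 ≤ n.descFactorial 4 := by
    have := Nat.pow_sub_le_descFactorial n 4
    have h2 : ((n + 1 - 4 : ℕ) : ℝ) = (n : ℝ) - 3 := by
      rw [Nat.cast_sub (by omega)]; push_cast; ring
    rw [← h2]
    exact_mod_cast this
  have h3 : (0 : ℝ) < (n : ℝ) - 3 := by linarith
  have h4 : ((1 - 3 / (n : ℝ)) ^ 4)⁻¹ = (n : ℝ) ^ 4 / ((n : ℝ) - 3) ^ 4 := by
    rw [show 1 - 3 / (n : ℝ) = ((n : ℝ) - 3) / n by field_simp, div_pow, inv_div]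
  rw [h4, replacementFactor]
  gcongr

theorem tendsto_replacementFactor_pow {t : ℕ → ℕ}
    (ht : Tendsto (fun n : ℕ => (t n : ℝ) / n) atTop (𝓝 0)) :
    Tendsto (fun n : ℕ => replacementFactor n ^ t n) atTop (𝓝 1) := by
  have h1 : Tendsto (fun n : ℕ => (((1 - 3 / (n : ℝ)) ^ t n) ^ 4)⁻¹) atTop (𝓝 1) := by
    simpa using ((tendsto_one_sub_div_pow ht (x := 3) (by norm_num)).pow 4).inv₀ (by norm_num)
  refine tendsto_of_tendsto_of_tendsto_of_le_of_le' tendsto_const_nhds h1 ?_ ?_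
  · filter_upwards [eventually_ge_atTop 4] with n hn
    exact one_le_pow₀ (one_le_replacementFactor hn)
  · filter_upwards [eventually_ge_atTop 4] with n hn
    rw [pow_right_comm, ← inv_pow]
    exact pow_le_pow_left₀ (replacementFactor_nonneg n) (replacementFactor_le hn) _

theorem tendsto_secondMomentError {t : ℕ → ℕ}
    (ht : Tendsto (fun n : ℕ => (t n : ℝ) / n) atTop (𝓝 0)) {y : ℕ → ℝ}
    (hy : Tendsto y atTop atTop) :
    Tendsto (fun n => secondMomentError n (t n) (y n)) atTop (𝓝 0) := by
  have h1 := tendsto_replacementFactor_pow ht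
  have h2 := tendsto_one_sub_div_pow ht (x := 2) (by norm_num)
  have h3 : Tendsto (fun n : ℕ => 1 - 1 / (n : ℝ)) atTop (𝓝 1) := by
    simpa using (tendsto_one_div_atTop_nhds_zero_nat (𝕜 := ℝ)).const_sub 1
  have h4 : Tendsto (fun n => 4 / Real.sqrt (y n)) atTop (𝓝 0) :=
    tendsto_const_nhds.div_atTop (Real.tendsto_sqrt_atTop.comp hy)
  have h5 : Tendsto (fun n => 2 / y n) atTop (𝓝 0) := tendsto_const_nhds.div_atTop hy
  have h := ((h1.div ((h3.mul h2).pow 2) (by norm_num)).mul ((h4.const_add 1).add h5)).sub_const 1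
  simpa [secondMomentError] using h

/-- Asymptotics of the probability that all cards are separated, at a sequence of times. -/
theorem tendsto_distinctProb {t : ℕ → ℕ} (ht : Tendsto t atTop atTop)
    (htn : Tendsto (fun n : ℕ => (t n : ℝ) / n) atTop (𝓝 0)) {M : ℕ → ℝ}
    (hM : Tendsto M atTop atTop) {c : ℝ}
    (h₁ : Tendsto (fun n : ℕ => (-2 * Real.log n - M n - t n * (Real.pi / 2 - 2)) /
      (Real.sqrt logAgreeVar * Real.sqrt (t n))) atTop (𝓝 c))
    (h₂ : Tendsto (fun n : ℕ => (-2 * Real.log n + M n - t n * (Real.pi / 2 - 2)) /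
      (Real.sqrt logAgreeVar * Real.sqrt (t n))) atTop (𝓝 c)) :
    Tendsto (fun n => distinctProb n (t n)) atTop (𝓝 (normalCDF c)) := by
  have h4 : Tendsto (fun n : ℕ => M n - 4 * t n / n) atTop atTop := by
    have : Tendsto (fun n : ℕ => 4 * (t n : ℝ) / n) atTop (𝓝 0) := by
      simpa [mul_div_assoc] using htn.const_mul 4
    simpa [sub_eq_add_neg] using hM.atTop_add this.neg
  have h5 : Tendsto (fun n : ℕ => Real.exp (4 * t n / n - M n)) atTop (𝓝 0) := by
    refine Real.tendsto_exp_atBot.comp ?_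
    simpa only [Function.comp_def, neg_sub] using tendsto_neg_atTop_atBot.comp h4
  have h6 := tendsto_measureReal_sum_log_agreeProb_le ht h₁
  have h7 := tendsto_measureReal_sum_log_agreeProb_le ht h₂
  have hlow := (((tendsto_replacementFactor_pow htn).mul h5).const_sub 1).mul h6
  have hup := h7.add (tendsto_secondMomentError htn (Real.tendsto_exp_atTop.comp h4)).abs
  simp only [mul_zero, sub_zero, one_mul] at hlow
  simp only [abs_zero, add_zero] at hup
  refine tendsto_of_tendsto_of_tendsto_of_le_of_le' hlow hup ?_ ?_
  · filter_upwards [eventually_ge_atTop 4] with n hn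
    exact le_distinctProb hn _ _
  · filter_upwards [eventually_ge_atTop 4] with n hn
    exact distinctProb_le hn _ _

/-! ### Asymptotics of the time scale in the variable `s = √(log n)` -/

theorem tendsto_quadratic_atTop {a : ℝ} (ha : 0 < a) (d : ℝ) : Tendsto (fun s : ℝ => a * s ^ 2 + d * s) atTop atTop := by
  have h : Tendsto (fun s : ℝ => s * (a * s + d)) atTop atTop :=
    tendsto_id.atTop_mul_atTop₀ (tendsto_atTop_add_const_right _ _ (tendsto_id.const_mul_atTop ha))
  refine h.congr fun s => ?_
  ring

theorem tendsto_floor_quadratic_error {a : ℝ} (ha : 0 < a) (d : ℝ) :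
    Tendsto (fun s : ℝ => ((⌊a * s ^ 2 + d * s⌋₊ : ℝ) - a * s ^ 2 - d * s) / s) atTop (𝓝 0) := by
  rw [tendsto_zero_iff_abs_tendsto_zero]
  refine squeeze_zero' (Eventually.of_forall fun _ => abs_nonneg _) ?_ tendsto_inv_atTop_zero
  filter_upwards [eventually_gt_atTop 0, (tendsto_quadratic_atTop ha d).eventually_ge_atTop 0]
    with s hs hq
  rw [Function.comp, abs_div, abs_of_pos hs, inv_eq_one_div]
  refine div_le_div_of_nonneg_right ?_ hs.le
  have h1 := Nat.floor_le hq
  have h2 := Nat.lt_floor_add_one (a * s ^ 2 + d * s)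
  rw [abs_le]
  constructor <;> linarith

theorem tendsto_floor_quadratic_div_sq {a : ℝ} (ha : 0 < a) (d : ℝ) :
    Tendsto (fun s : ℝ => (⌊a * s ^ 2 + d * s⌋₊ : ℝ) / s ^ 2) atTop (𝓝 a) := by
  have h := (((tendsto_floor_quadratic_error ha d).mul tendsto_inv_atTop_zero).add
    (tendsto_inv_atTop_zero.const_mul d)).add_const a
  simp only [mul_zero, zero_add, add_zero] at h
  refine h.congr' ?_
  filter_upwards [eventually_gt_atTop 0] with s hs
  field_simp
  ring

/-- Here `-μ` is the mean of a step. The condition `a μ = 2` cancels the terms of order `s²`,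
leaving `μ d s`, while the denominator is asymptotic to `√(v a) s`. The margin `e √s` and the floor
error are of smaller order. -/
theorem tendsto_standardized_time {a : ℝ} (ha : 0 < a) (d : ℝ) {v μ : ℝ} (hv : 0 < v) (hμ : a * μ = 2) (e : ℝ) :
    Tendsto (fun s : ℝ => (-2 * s ^ 2 + e * Real.sqrt s + (⌊a * s ^ 2 + d * s⌋₊ : ℝ) * μ) /
      (Real.sqrt v * Real.sqrt (⌊a * s ^ 2 + d * s⌋₊ : ℝ))) atTop
      (𝓝 (μ * d / (Real.sqrt v * Real.sqrt a))) := by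
  have h1 : Tendsto (fun s : ℝ => (Real.sqrt s)⁻¹) atTop (𝓝 0) :=
    tendsto_inv_atTop_zero.comp Real.tendsto_sqrt_atTop
  have h2 := (Real.continuous_sqrt.tendsto a).comp (tendsto_floor_quadratic_div_sq ha d)
  have h3 := ((((tendsto_floor_quadratic_error ha d).const_mul μ).add_const (μ * d)).add
    (h1.const_mul e)).div (h2.const_mul (Real.sqrt v))
    (mul_pos (Real.sqrt_pos.2 hv) (Real.sqrt_pos.2 ha)).ne'
  simp only [mul_zero, zero_add, add_zero] at h3
  refine h3.congr' ?_
  filter_upwards [eventually_gt_atTop 0] with s hs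
  have hss : Real.sqrt s * Real.sqrt s = s := Real.mul_self_sqrt hs.le
  have hs' : Real.sqrt s ≠ 0 := (Real.sqrt_pos.2 hs).ne'
  have h4 : (Real.sqrt s)⁻¹ = Real.sqrt s / s := by
    rw [eq_div_iff hs.ne', inv_mul_eq_div, div_eq_iff hs', hss]
  simp only [Pi.div_apply, Function.comp]
  rw [Real.sqrt_div' _ (by positivity), Real.sqrt_sq hs.le, h4]
  have h5 : μ * (((⌊a * s ^ 2 + d * s⌋₊ : ℝ) - a * s ^ 2 - d * s) / s) + μ * d +
      e * (Real.sqrt s / s) =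
      (-2 * s ^ 2 + e * Real.sqrt s + (⌊a * s ^ 2 + d * s⌋₊ : ℝ) * μ) / s := by
    rw [← hμ]
    field_simp
    ring
  rw [h5, ← mul_div_assoc, div_div_div_cancel_right₀ hs.ne']

/-! ### The constants `a` and `b`, and the conclusion -/

theorem riffleA_pos : 0 < riffleA :=
  div_pos (by norm_num) (by linarith [Real.pi_lt_four])

theorem riffleB_pos : 0 < riffleB :=
  div_pos (mul_pos (by norm_num) (Real.sqrt_pos.2 variance_constant_pos))
    (Real.rpow_pos_of_pos (by linarith [Real.pi_lt_four]) _)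

theorem riffleA_mul_mean : riffleA * (2 - Real.pi / 2) = 2 := by
  have : 4 - Real.pi ≠ 0 := by linarith [Real.pi_lt_four]
  unfold riffleA
  field_simp
  ring

/-- This relation is what singles out `b`: it turns the limiting standardized threshold for the
shift `d` into `d / b`. -/
theorem mean_mul_riffleB :
    (2 - Real.pi / 2) * riffleB = Real.sqrt logAgreeVar * Real.sqrt riffleA := by
  have h : 0 < 4 - Real.pi := by linarith [Real.pi_lt_four]
  have h1 : (4 - Real.pi) ^ (3 / 2 : ℝ) = (4 - Real.pi) * Real.sqrt (4 - Real.pi) := by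
    rw [show (3 / 2 : ℝ) = 1 + 1 / 2 by norm_num, Real.rpow_add h, Real.rpow_one,
      Real.sqrt_eq_rpow]
  have h2 : Real.sqrt riffleA = 2 / Real.sqrt (4 - Real.pi) := by
    rw [riffleA, Real.sqrt_div' _ h.le, show (4 : ℝ) = 2 ^ 2 by norm_num,
      Real.sqrt_sq (by norm_num)]
  have h3 := (Real.sqrt_pos.2 h).ne'
  rw [h2, riffleB, h1, logAgreeVar]
  field_simp
  ring

theorem tendsto_sqrt_log_natCast :
    Tendsto (fun n : ℕ => Real.sqrt (Real.log n)) atTop atTop :=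
  Real.tendsto_sqrt_atTop.comp (Real.tendsto_log_atTop.comp tendsto_natCast_atTop_atTop)

/-- A free coefficient `d` serves both claims: `d = b c` gives the profile, and `d = ± c` the cutoff
window. -/
theorem tendsto_riffleSeparation (d : ℝ) :
    Tendsto (fun n : ℕ => riffleSeparation n
      ⌊riffleA * Real.log n + d * Real.sqrt (Real.log n)⌋₊) atTop
      (𝓝 (1 - normalCDF (d / riffleB))) := by
  simp_rw [riffleSeparation_eq]
  refine Tendsto.const_sub 1 ?_
  have hs := tendsto_sqrt_log_natCast
  have hsq : ∀ n : ℕ, Real.sqrt (Real.log n) ^ 2 = Real.log n := fun n =>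
    Real.sq_sqrt (Real.log_natCast_nonneg n)
  have hv : 0 < logAgreeVar := variance_constant_pos
  have hc : (2 - Real.pi / 2) * d / (Real.sqrt logAgreeVar * Real.sqrt riffleA) =
      d / riffleB := by
    have hm : 2 - Real.pi / 2 ≠ 0 := by linarith [Real.pi_lt_four]
    rw [← mean_mul_riffleB, mul_div_mul_left _ _ hm]
  have hT := fun e => (tendsto_standardized_time riffleA_pos d hv riffleA_mul_mean e).comp hs
  simp only [Function.comp_def, hsq, hc] at hT
  -- The margin `(log n)^(1/4)` tends to infinity but is negligible against `√(log n)`; it enters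
  -- with coefficient `e = -1` and `e = 1`.
  refine tendsto_distinctProb (M := fun n => Real.sqrt (Real.sqrt (Real.log n))) ?_ ?_
    (Real.tendsto_sqrt_atTop.comp hs) ((hT (-1)).congr fun n => ?_) ((hT 1).congr fun n => ?_)
  · have := tendsto_nat_floor_atTop.comp ((tendsto_quadratic_atTop riffleA_pos d).comp hs)
    simpa only [Function.comp_def, hsq] using this
  · have h1 := (tendsto_floor_quadratic_div_sq riffleA_pos d).comp hs
    simp only [Function.comp_def, hsq] at h1
    have h2 : Tendsto (fun n : ℕ => Real.log n / n) atTop (𝓝 0) :=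
      Real.isLittleO_log_id_atTop.tendsto_div_nhds_zero.comp tendsto_natCast_atTop_atTop
    have h3 := h1.mul h2
    rw [mul_zero] at h3
    refine h3.congr' ?_
    filter_upwards [eventually_gt_atTop 1] with n hn
    have : 0 < Real.log n := Real.log_pos (by exact_mod_cast hn)
    rw [div_mul_div_cancel₀ this.ne']
  · ring_nf
  · ring_nf

theorem mainTheorem2 :
    (∀ c : ℝ, Tendsto
      (fun n : ℕ => riffleSeparation n
        ⌊riffleA * Real.log n + riffleB * c * Real.sqrt (Real.log n)⌋₊)
      atTop (𝓝 (1 - normalCDF c))) ∧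
    HasCutoff riffleSeparation
      (fun n : ℕ => riffleA * Real.log n)
      (fun n : ℕ => Real.sqrt (Real.log n)) := by
  have hB := riffleB_pos
  have hbot : Tendsto normalCDF atBot (𝓝 0) := ProbabilityTheory.tendsto_cdf_atBot _
  have htop : Tendsto normalCDF atTop (𝓝 1) := ProbabilityTheory.tendsto_cdf_atTop _
  refine ⟨fun c => ?_, ?_, ⟨fun c => 1 - normalCDF (-c / riffleB), fun c => ?_, ?_⟩,
    ⟨fun c => 1 - normalCDF (c / riffleB), fun c => ?_, ?_⟩⟩
  · simpa [mul_div_cancel_left₀ c hB.ne'] using tendsto_riffleSeparation (riffleB * c)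
  · refine Asymptotics.isLittleO_of_tendsto' ?_ ?_
    · filter_upwards [eventually_gt_atTop 1] with n hn h
      have : 0 < Real.log n := Real.log_pos (by exact_mod_cast hn)
      exact absurd h (mul_pos riffleA_pos this).ne'
    · have h := (tendsto_inv_atTop_zero.comp tendsto_sqrt_log_natCast).const_mul riffleA⁻¹
      rw [mul_zero] at h
      refine h.congr fun n => ?_
      rw [Function.comp, ← div_div, div_right_comm, Real.sqrt_div_self', one_div, div_eq_inv_mul]
  · simpa [sub_eq_add_neg] using tendsto_riffleSeparation (-c)
  · have := (hbot.comp (tendsto_neg_atTop_atBot.atBot_div_const hB)).const_sub 1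
    simpa [Function.comp_def] using this
  · exact tendsto_riffleSeparation c
  · have := (htop.comp (tendsto_id.atTop_div_const hB)).const_sub 1
    simpa [Function.comp_def] using this
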